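/- **Single impurity in a magnetic ring chain.** Let $A,\alpha\in\mathbb R$. Let $\Gamma$ be the infinite chain of rings of circumference $2\pi$ touching at the vertices $j\pi$, $j\in\mathbb Z$: its upper and lower semicircles are parametrized by two copies of $\mathbb R$, the $j$-th ring consisting of the two copies of $\mathcal I_j=[j\pi,(j+1)\pi]$, and $L^2(\Gamma)=L^2(\mathbb R)\oplus L^2(\mathbb R)$. Write elements of $L^2(\Gamma)$ as $(\psi,\varphi)$ with restrictions $\psi_j,\varphi_j$ to $\mathcal I_j$, and put $\mathcal D=\frac{d}{dx}+iA$ on the upper and $\mathcal D=\frac{d}{dx}-iA$ on the lower semicircles. For a real sequence $\boldsymbol\alpha=(\alpha_j)_{j\in\mathbb Z}$ let $-\Delta_{\boldsymbol\alpha}$ be the operator in $L^2(\Gamma)$ acting as $-\mathcal D^2$ on each edge, whose domain consists of all $(\psi,\varphi)\in L^2(\Gamma)$ that are $H^2$ on each edge, satisfy $(\mathcal D^2\psi,\mathcal D^2\varphi)\in L^2(\Gamma)$, and obey for all $j\in\mathbb Z$ the $\delta$-coupling conditions $$\psi_j(j\pi)=\varphi_j(j\pi)=\psi_{j-1}(j\pi)=\varphi_{j-1}(j\pi),$$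 $$\mathcal D\psi_j(j\pi)+\mathcal D\varphi_j(j\pi)-\mathcal D\psi_{j-1}(j\pi)-\mathcal D\varphi_{j-1}(j\pi)=\alpha_j\,\psi_j(j\pi).$$ Let $-\Delta_\alpha$ be this operator with $\alpha_j=\alpha$ for all $j$ and, for $\gamma_1\in\mathbb R$, let $-\Delta_{\boldsymbol\alpha+\boldsymbol\gamma^{(1)}}$ be this operator with $\alpha_1=\alpha+\gamma_1$ and $\alpha_j=\alpha$ for $j\ne1$. Assume $A\notin\mathbb Z$. Then the essential spectrum of $-\Delta_{\boldsymbol\alpha+\boldsymbol\gamma^{(1)}}$ coincides with the spectrum of $-\Delta_\alpha$. Its gaps, i.e. the connected components of the complement of the essential spectrum in $\mathbb R$, form an infinite sequence $G_1,G_2,G_3,\dots$ ordered from left to right. If $\gamma_1<0$, then $-\Delta_{\boldsymbol\alpha+\boldsymbol\gamma^{(1)}}$ has precisely one eigenvalue in every odd gap $G_1,G_3,G_5,\dots$, and it is simple. If $\gamma_1>0$, then it has precisely one eigenvalue in every even gap $G_2,G_4,G_6,\dots$, and it is simple. -/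

import Mathlib

open MeasureTheory Set

noncomputable section

namespace RingChain

/-! ### The chain graph

The upper and the lower semicircles of the chain are parametrized by two copies of `ℝ`, indexed
by `Fin 2` (`0` is the upper copy, `1` the lower one). The two copies are glued at the points
`j * π`, `j : ℤ`, and the `j`-th ring consists of the two copies of `[j * π, (j + 1) * π]`. -/

/-- The coordinate of the `j`-th vertex. -/
def vertex (j : ℤ) : ℝ := j * Real.pi

/-- The coordinate interval of (either of) the two edges of the `j`-th ring. -/
def edge (j : ℤ) : Set ℝ := Icc (vertex j) (vertex (j + 1))

/-- The Hilbert space `L²(Γ) = L²(ℝ) ⊕ L²(ℝ)`. -/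
abbrev L2Graph : Type := PiLp 2 (fun _ : Fin 2 => Lp ℂ 2 (volume : Measure ℝ))

/-- The tangential component of the vector potential: `-A` on the upper semicircles and `A` on the
lower ones. -/
def potential (A : ℝ) : Fin 2 → ℝ := ![-A, A]

/-- On the `j`-th edge with potential value `a`, the function `u` is absolutely continuous and
its quasiderivative `𝒟u = u' - i a u` equals `v` almost everywhere. -/
def HasQuasiDeriv (a : ℝ) (j : ℤ) (u v : ℝ → ℂ) : Prop :=
  ContinuousOn u (edge j) ∧ IntervalIntegrable v volume (vertex j) (vertex (j + 1)) ∧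
    ∀ x ∈ edge j, u x = u (vertex j) + ∫ t in vertex j..x, (v t + Complex.I * a * u t)

/-- `(f, g)` belongs to the graph of the magnetic Laplacian with `δ`-couplings of strengths `α j`
at the vertices: on each edge `f` is represented by an `H²` function `u s j` with quasiderivative
`p s j` (both continuous up to the end points of the edge), `-𝒟² f = g`, the function is continuous
at the vertices, and the sum of the outgoing quasiderivatives at the `j`-th vertex equals `α j`
times the value there. Since `g ∈ L²(Γ)`, this forces `f ∈ H²` on each edge. -/
def IsHamiltonianPair (A : ℝ) (α : ℤ → ℝ) (f g : L2Graph) : Prop :=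
  ∃ u p : Fin 2 → ℤ → ℝ → ℂ,
    (∀ s j, (f s : ℝ → ℂ) =ᵐ[volume.restrict (edge j)] u s j) ∧
    (∀ s j, HasQuasiDeriv (potential A s) j (u s j) (p s j)) ∧
    (∀ s j, HasQuasiDeriv (potential A s) j (p s j) (fun x => -(g s : ℝ → ℂ) x)) ∧
    (∀ s j, u s j (vertex j) = u 0 j (vertex j) ∧ u s (j - 1) (vertex j) = u 0 j (vertex j)) ∧
    ∀ j, ∑ s, (p s j (vertex j) - p s (j - 1) (vertex j)) = (α j : ℂ) * u 0 j (vertex j)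

theorem vertex_lt (j : ℤ) : vertex j < vertex (j + 1) := by
  unfold vertex
  have := Real.pi_pos
  push_cast
  nlinarith

theorem HasQuasiDeriv.integrand {a : ℝ} {j : ℤ} {u v : ℝ → ℂ} (h : HasQuasiDeriv a j u v)
    {x : ℝ} (hx : x ∈ edge j) :
    IntervalIntegrable (fun t => v t + Complex.I * a * u t) volume (vertex j) x := by
  have hle := (vertex_lt j).le
  have h1 : IntervalIntegrable (fun t => v t + Complex.I * a * u t) volume
      (vertex j) (vertex (j + 1)) := by
    refine h.2.1.add ?_
    have : ContinuousOn (fun t => Complex.I * a * u t) (uIcc (vertex j) (vertex (j + 1))) := by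
      rw [uIcc_of_le hle]
      exact continuousOn_const.mul h.1
    exact this.intervalIntegrable
  refine h1.mono_set ?_
  rw [uIcc_of_le hle, uIcc_of_le hx.1]
  exact Icc_subset_Icc le_rfl hx.2

theorem HasQuasiDeriv.add {a : ℝ} {j : ℤ} {u v u' v' : ℝ → ℂ} (h : HasQuasiDeriv a j u v)
    (h' : HasQuasiDeriv a j u' v') : HasQuasiDeriv a j (u + u') (v + v') := by
  refine ⟨h.1.add h'.1, h.2.1.add h'.2.1, fun x hx => ?_⟩
  have e : ∀ t, (v + v') t + Complex.I * a * (u + u') t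
      = (v t + Complex.I * a * u t) + (v' t + Complex.I * a * u' t) := by
    intro t
    simp only [Pi.add_apply]
    ring
  simp only [e]
  rw [intervalIntegral.integral_add (h.integrand hx) (h'.integrand hx)]
  simp only [Pi.add_apply]
  rw [h.2.2 x hx, h'.2.2 x hx]
  ring

theorem HasQuasiDeriv.smul {a : ℝ} {j : ℤ} {u v : ℝ → ℂ} (c : ℂ) (h : HasQuasiDeriv a j u v) :
    HasQuasiDeriv a j (c • u) (c • v) := by
  refine ⟨h.1.const_smul c, h.2.1.smul c, fun x hx => ?_⟩
  have e : ∀ t, (c • v) t + Complex.I * a * (c • u) t = c * (v t + Complex.I * a * u t) := by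
    intro t
    simp only [Pi.smul_apply, smul_eq_mul]
    ring
  simp only [e]
  rw [intervalIntegral.integral_const_mul]
  simp only [Pi.smul_apply, smul_eq_mul]
  rw [h.2.2 x hx]
  ring

theorem HasQuasiDeriv.congr {a : ℝ} {j : ℤ} {u v v' : ℝ → ℂ} (h : HasQuasiDeriv a j u v)
    (hv : v =ᵐ[volume] v') : HasQuasiDeriv a j u v' := by
  refine ⟨h.1, h.2.1.congr_ae (ae_restrict_of_ae hv), fun x hx => ?_⟩
  rw [h.2.2 x hx]
  congr 1
  refine intervalIntegral.integral_congr_ae ?_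
  filter_upwards [hv] with t ht _
  rw [ht]

theorem HasQuasiDeriv.ae_zero {a : ℝ} {j : ℤ} {u v : ℝ → ℂ} (h : HasQuasiDeriv a j u v)
    (hu : ∀ x ∈ edge j, u x = 0) : v =ᵐ[volume.restrict (edge j)] 0 := by
  have hle := (vertex_lt j).le
  have hl : vertex j ∈ edge j := ⟨le_rfl, hle⟩
  have key : ∀ x ∈ edge j, ∫ t in vertex j..x, v t = 0 := by
    intro x hx
    have h1 := h.2.2 x hx
    rw [hu x hx, hu _ hl, zero_add] at h1
    rw [h1]
    refine intervalIntegral.integral_congr fun t ht => ?_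
    rw [uIcc_of_le hx.1] at ht
    have : u t = 0 := hu t ⟨ht.1, ht.2.trans hx.2⟩
    simp [this]
  have hd := h.2.1.ae_hasDerivAt_integral
  have hIoo : v =ᵐ[volume.restrict (Ioo (vertex j) (vertex (j + 1)))] 0 := by
    rw [Filter.EventuallyEq, ae_restrict_iff' measurableSet_Ioo]
    filter_upwards [hd] with x hx hxm
    rw [uIcc_of_le hle] at hx
    have h2 := hx (Ioo_subset_Icc_self hxm) _ hl
    refine h2.unique ((hasDerivAt_const x (0 : ℂ)).congr_of_eventuallyEq ?_)
    filter_upwards [isOpen_Ioo.mem_nhds hxm] with y hy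
    exact key y (Ioo_subset_Icc_self hy)
  have : (volume : Measure ℝ).restrict (edge j)
      = volume.restrict (Ioo (vertex j) (vertex (j + 1))) :=
    (Measure.restrict_congr_set Ioo_ae_eq_Icc).symm
  rw [this]
  exact hIoo

theorem exists_mem_edge (x : ℝ) : ∃ j, x ∈ edge j := by
  have hpi := Real.pi_pos
  refine ⟨⌊x / Real.pi⌋, ?_, ?_⟩
  · have := Int.floor_le (x / Real.pi)
    rw [le_div_iff₀ hpi] at this
    exact this
  · have := (Int.lt_floor_add_one (x / Real.pi)).le
    rw [div_le_iff₀ hpi] at this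
    simpa [vertex] using this

/-- The graph of the Hamiltonian as a subspace of `L²(Γ) × L²(Γ)`. -/
def hamiltonianGraph (A : ℝ) (α : ℤ → ℝ) : Submodule ℂ (L2Graph × L2Graph) where
  carrier := {x | IsHamiltonianPair A α x.1 x.2}
  zero_mem' := by
    refine ⟨0, 0, fun s j => ?_, fun s j => ?_, fun s j => ?_, by simp, by simp⟩
    · exact ae_restrict_of_ae (Lp.coeFn_zero ℂ 2 volume)
    · refine ⟨continuousOn_const, ?_, fun x _ => by simp⟩
      simp only [Pi.zero_apply]
      exact intervalIntegrable_const (c := (0 : ℂ))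
    · have h0 : HasQuasiDeriv (potential A s) j 0 0 := by
        refine ⟨continuousOn_const, ?_, fun x _ => by simp⟩
        exact intervalIntegrable_const (c := (0 : ℂ))
      refine h0.congr ?_
      filter_upwards [Lp.coeFn_zero ℂ 2 (volume : Measure ℝ)] with x hx
      have hx' : (((0 : L2Graph × L2Graph).2 s : Lp ℂ 2 (volume : Measure ℝ)) : ℝ → ℂ) x = 0 := hx
      rw [hx']
      simp
  add_mem' := by
    rintro ⟨f, g⟩ ⟨f', g'⟩ ⟨u, p, h1, h2, h3, h4, h5⟩ ⟨u', p', h1', h2', h3', h4', h5'⟩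
    refine ⟨u + u', p + p', fun s j => ?_, fun s j => (h2 s j).add (h2' s j), fun s j => ?_,
      fun s j => ?_, fun j => ?_⟩
    · filter_upwards [ae_restrict_of_ae (Lp.coeFn_add (f s) (f' s)), h1 s j, h1' s j]
        with x e1 e2 e3
      refine e1.trans ?_
      simp only [Pi.add_apply, e2, e3]
    · refine ((h3 s j).add (h3' s j)).congr ?_
      filter_upwards [Lp.coeFn_add (g s) (g' s)] with x e1
      have e1' : (((f, g) + (f', g') : L2Graph × L2Graph).2 s : ℝ → ℂ) x
          = (g s : ℝ → ℂ) x + (g' s : ℝ → ℂ) x := e1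
      rw [e1']
      simp only [Pi.add_apply]
      ring
    · simp only [Pi.add_apply]
      rw [(h4 s j).1, (h4 s j).2, (h4' s j).1, (h4' s j).2]
      exact ⟨rfl, rfl⟩
    · have a1 := h5 j
      have a2 := h5' j
      simp only [Fin.sum_univ_two, Pi.add_apply] at a1 a2 ⊢
      linear_combination a1 + a2
  smul_mem' := by
    rintro c ⟨f, g⟩ ⟨u, p, h1, h2, h3, h4, h5⟩
    refine ⟨c • u, c • p, fun s j => ?_, fun s j => (h2 s j).smul c, fun s j => ?_,
      fun s j => ?_, fun j => ?_⟩
    · filter_upwards [ae_restrict_of_ae (Lp.coeFn_smul c (f s)), h1 s j] with x e1 e2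
      refine e1.trans ?_
      simp only [Pi.smul_apply, e2]
    · refine ((h3 s j).smul c).congr ?_
      filter_upwards [Lp.coeFn_smul c (g s)] with x e1
      have e1' : ((c • (f, g) : L2Graph × L2Graph).2 s : ℝ → ℂ) x = c • (g s : ℝ → ℂ) x := e1
      rw [e1']
      simp
    · simp only [Pi.smul_apply]
      rw [(h4 s j).1, (h4 s j).2]
      exact ⟨rfl, rfl⟩
    · have a1 := h5 j
      simp only [Fin.sum_univ_two, Pi.smul_apply, smul_eq_mul] at a1 ⊢
      linear_combination c * a1

theorem hamiltonianGraph_single_valued (A : ℝ) (α : ℤ → ℝ) :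
    ∀ x ∈ hamiltonianGraph A α, x.1 = 0 → x.2 = 0 := by
  rintro ⟨f, g⟩ ⟨u, p, h1, h2, h3, -, -⟩ hf
  have hf' : f = 0 := hf
  subst hf'
  change g = 0
  have hu : ∀ s j, ∀ x ∈ edge j, u s j x = 0 := by
    intro s j
    have e : u s j =ᵐ[volume.restrict (edge j)] 0 :=
      (h1 s j).symm.trans (ae_restrict_of_ae (Lp.coeFn_zero ℂ 2 volume))
    exact Measure.eqOn_Icc_of_ae_eq volume (vertex_lt j).ne e (h2 s j).1 continuousOn_const
  have hp : ∀ s j, ∀ x ∈ edge j, p s j x = 0 := by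
    intro s j
    exact Measure.eqOn_Icc_of_ae_eq volume (vertex_lt j).ne ((h2 s j).ae_zero (hu s j))
      (h3 s j).1 continuousOn_const
  ext s : 1
  refine (Lp.eq_zero_iff_ae_eq_zero).2 ?_
  have hall : ∀ᵐ x, ∀ j, x ∈ edge j → -(g s : ℝ → ℂ) x = 0 := by
    rw [ae_all_iff]
    intro j
    exact (ae_restrict_iff' measurableSet_Icc).1 ((h3 s j).ae_zero (hp s j))
  filter_upwards [hall] with x hx
  obtain ⟨j, hj⟩ := exists_mem_edge x
  exact neg_eq_zero.1 (hx j hj)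

/-- The magnetic Hamiltonian of the ring chain with `δ`-couplings of strengths `α j`, as an
unbounded operator in `L²(Γ)`. -/
def hamiltonian (A : ℝ) (α : ℤ → ℝ) : L2Graph →ₗ.[ℂ] L2Graph :=
  (hamiltonianGraph A α).toLinearPMap

theorem mem_graph_hamiltonian (A : ℝ) (α : ℤ → ℝ) (f g : L2Graph) :
    (f, g) ∈ (hamiltonian A α).graph ↔ IsHamiltonianPair A α f g := by
  unfold hamiltonian
  rw [Submodule.toLinearPMap_graph_eq _ (hamiltonianGraph_single_valued A α)]
  exact Iff.rfl

/-! ### Spectral notions for unbounded operators -/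

section Spectrum

variable {H : Type*} [NormedAddCommGroup H] [NormedSpace ℂ H]

/-- The linear map `T - z` on the domain of `T`. -/
def shifted (T : H →ₗ.[ℂ] H) (z : ℂ) : T.domain →ₗ[ℂ] H := T.toFun - z • T.domain.subtype

/-- The spectrum: the set of `z` for which `T - z` is not a bijection from the domain of `T` onto
the whole space with a bounded inverse. -/
def spectrumSet (T : H →ₗ.[ℂ] H) : Set ℂ :=
  {z | ¬ (Function.Bijective (shifted T z) ∧
    ∃ C : ℝ, ∀ x : T.domain, ‖(x : H)‖ ≤ C * ‖shifted T z x‖)}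

/-- The eigenspace of `T` for `z` (the zero space if `z` is not an eigenvalue). -/
def eigenspace (T : H →ₗ.[ℂ] H) (z : ℂ) : Submodule ℂ T.domain := LinearMap.ker (shifted T z)

/-- The essential spectrum: the set of `z` for which `T - z` is not a Fredholm operator, that is,
its kernel has infinite dimension, or its range is not closed or has infinite codimension. For a
self-adjoint operator it is the spectrum without the isolated eigenvalues of finite multiplicity. -/
def essentialSpectrum (T : H →ₗ.[ℂ] H) : Set ℂ :=
  {z | ¬ (FiniteDimensional ℂ (LinearMap.ker (shifted T z)) ∧
    IsClosed (LinearMap.range (shifted T z) : Set H) ∧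
    FiniteDimensional ℂ (H ⧸ LinearMap.range (shifted T z)))}

/-- There is precisely one eigenvalue of `T` in the set `G` of real numbers, and it is simple. -/
def HasUniqueSimpleEigenvalueIn (T : H →ₗ.[ℂ] H) (G : Set ℝ) : Prop :=
  ∃ E ∈ G, Module.finrank ℂ (eigenspace T (E : ℂ)) = 1 ∧
    ∀ E' ∈ G, eigenspace T (E' : ℂ) ≠ ⊥ → E' = E

end Spectrum

/-- The gaps of `S ⊆ ℂ` on the real line: the connected components of `ℝ \ S`. -/
def IsGap (S : Set ℂ) (G : Set ℝ) : Prop :=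
  ∃ x : ℝ, (x : ℂ) ∉ S ∧ G = connectedComponentIn {y : ℝ | (y : ℂ) ∉ S} x

/-- `G 0, G 1, G 2, …` is the list of all gaps of `S`, ordered from the left to the right; thus
`G n` is the gap number `n + 1`. -/
def IsGapEnumeration (S : Set ℂ) (G : ℕ → Set ℝ) : Prop :=
  (∀ I : Set ℝ, IsGap S I ↔ ∃ n, I = G n) ∧
    ∀ m n, m < n → ∀ x ∈ G m, ∀ y ∈ G n, x < y

/-- The constant sequence of coupling strengths `α`. -/
def periodicCoupling (α : ℝ) : ℤ → ℝ := fun _ => α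

/-- The coupling strengths with a single impurity of strength `γ` at the vertex number `1`. -/
def impurityCoupling (α γ : ℝ) : ℤ → ℝ := fun j => if j = 1 then α + γ else α

end RingChain

end

/-! The differential operator reduces to a difference operator. Unless `z` is a Dirichlet energy, a
zero of `sinEnd z = sin (π √z) / √z`, the solutions of `-𝒟² f - z f = h` on an edge are determined
by their values at the two end points. The coupling conditions then become a second order
difference equation in `ℓ²(ℤ)` for the vertex values: the hopping strength is `cos (A π)`, the
diagonal is given by the discriminant `cos (π √z) + α sin (π √z) / (4 √z)`, and the impurity is a
perturbation of rank one. The kernels of the two operators agree, and one has closed range and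
finite defects if and only if the other one has.

The hopping operator is self-adjoint of norm at most `2 |cos (A π)|`, so the difference operator
without impurity is invertible where the discriminant is outside `[-|cos (A π)|, |cos (A π)|]`;
where it is inside, pieces of plane waves form a singular sequence. The Dirichlet energies are flat
bands, with eigenfunctions supported on two adjacent rings. As `|cos (A π)| < 1`, each interval
between the Dirichlet energies contains one band, with a gap on either side of it.

In a gap, a square summable solution decays geometrically from the impurity on both sides, so it is
unique up to a factor, and the equation at the impurity is
`(γ / 4) sin (π √z) / √z = cos (A π) l - discr z`, where `l` is the decaying root of
`cos (A π) (l² + 1) = 2 (discr z) l`. The sign of the right-hand side is that of `-discr z`, which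
decides the gaps that can contain an eigenvalue, and in those the equation may be squared. Divided
by `sin² (π √z) / z`, the squared equation says that the product of two edge functions is
`(γ / 4)²`; both are strictly decreasing between the Dirichlet energies and have the same sign in a
gap, so there is exactly one solution. -/

noncomputable section

namespace RingChain

/-! ### Primitives of integrable functions -/

section Primitive

variable {E : Type*} [NormedAddCommGroup E] [NormedSpace ℝ E] {m m' U U' : ℝ → E} {a b : ℝ}

theorem absolutelyContinuousOnInterval_intervalIntegral {c : ℝ}
    (hm : IntervalIntegrable m volume a b) (hc : c ∈ uIcc a b) :
    AbsolutelyContinuousOnInterval (fun x => ∫ t in c..x, m t) a b := by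
  have hnorm := hm.norm.absolutelyContinuousOnInterval_intervalIntegral hc
  rw [absolutelyContinuousOnInterval_iff] at hnorm ⊢
  intro ε hε
  obtain ⟨δ, hδ, h⟩ := hnorm ε hε
  refine ⟨δ, hδ, fun I hI hlt => (Finset.sum_le_sum fun i hi => ?_).trans_lt (h I hI hlt)⟩
  obtain ⟨hx, hy⟩ := hI.1 i hi
  have hcx : IntervalIntegrable m volume c (I.2 i).1 := hm.mono_set (uIcc_subset_uIcc hc hx)
  have hcy : IntervalIntegrable m volume c (I.2 i).2 := hm.mono_set (uIcc_subset_uIcc hc hy)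
  rw [dist_eq_norm, dist_eq_norm, intervalIntegral.integral_interval_sub_left hcx hcy,
    intervalIntegral.integral_interval_sub_left hcx.norm hcy.norm]
  exact intervalIntegral.norm_integral_le_abs_integral_norm

/-- `U` is a primitive of the integrable function `m` on the interval with end points `a` and `b`,
that is, `U` is absolutely continuous there and `U' = m` almost everywhere. -/
structure IsPrimitiveOn (m U : ℝ → E) (a b : ℝ) : Prop where
  intervalIntegrable : IntervalIntegrable m volume a b
  eq_add_integral : ∀ x ∈ uIcc a b, U x = U a + ∫ t in a..x, m t

namespace IsPrimitiveOn

theorem const_add_integral (hm : IntervalIntegrable m volume a b) (C : E) :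
    IsPrimitiveOn m (fun x => C + ∫ t in a..x, m t) a b :=
  ⟨hm, fun x _ => by simp⟩

theorem of_hasDerivAt [CompleteSpace E] (hU : ∀ x, HasDerivAt U (m x) x) (hm : Continuous m) :
    IsPrimitiveOn m U a b where
  intervalIntegrable := hm.intervalIntegrable a b
  eq_add_integral x _ := by
    rw [intervalIntegral.integral_eq_sub_of_hasDerivAt (fun y _ => hU y)
      (hm.intervalIntegrable a x), add_sub_cancel]

theorem mono_right (h : IsPrimitiveOn m U a b) {y : ℝ} (hy : y ∈ uIcc a b) :
    IsPrimitiveOn m U a y :=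
  ⟨h.intervalIntegrable.mono_set (uIcc_subset_uIcc left_mem_uIcc hy),
    fun x hx => h.eq_add_integral x (uIcc_subset_uIcc left_mem_uIcc hy hx)⟩

theorem congr (h : IsPrimitiveOn m U a b) (hm : ∀ᵐ x, x ∈ uIcc a b → m x = m' x)
    (hU : EqOn U U' (uIcc a b)) : IsPrimitiveOn m' U' a b := by
  refine ⟨h.intervalIntegrable.congr_ae ?_, fun x hx => ?_⟩
  · rw [Filter.EventuallyEq, ae_restrict_iff' measurableSet_uIoc]
    filter_upwards [hm] with x hx hxm using hx (uIoc_subset_uIcc hxm)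
  · rw [← hU hx, ← hU left_mem_uIcc, h.eq_add_integral x hx]
    refine congrArg _ (intervalIntegral.integral_congr_ae ?_)
    filter_upwards [hm] with t ht htm
    exact ht (uIcc_subset_uIcc left_mem_uIcc hx (uIoc_subset_uIcc htm))

theorem add (h : IsPrimitiveOn m U a b) (h' : IsPrimitiveOn m' U' a b) :
    IsPrimitiveOn (fun x => m x + m' x) (fun x => U x + U' x) a b := by
  refine ⟨h.intervalIntegrable.add h'.intervalIntegrable, fun x hx => ?_⟩
  rw [intervalIntegral.integral_add (h.mono_right hx).intervalIntegrable
    (h'.mono_right hx).intervalIntegrable, h.eq_add_integral x hx, h'.eq_add_integral x hx]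
  abel

theorem absolutelyContinuousOnInterval (h : IsPrimitiveOn m U a b) :
    AbsolutelyContinuousOnInterval (fun x => U a + ∫ t in a..x, m t) a b :=
  (LipschitzOnWith.of_dist_le_mul (K := 0) (f := fun _ : ℝ => U a) (by simp)
    ).absolutelyContinuousOnInterval.add
      (absolutelyContinuousOnInterval_intervalIntegral h.intervalIntegrable left_mem_uIcc)

theorem continuousOn (h : IsPrimitiveOn m U a b) : ContinuousOn U (uIcc a b) :=
  h.absolutelyContinuousOnInterval.continuousOn.congr h.eq_add_integral

variable {𝔸 : Type*} [NormedRing 𝔸] [NormMulClass 𝔸] [NormedAlgebra ℝ 𝔸]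
  [CompleteSpace 𝔸] {χ χ' n V : ℝ → 𝔸}

theorem mul_left (h : IsPrimitiveOn n V a b) (hχ : ∀ x, HasDerivAt χ (χ' x) x)
    (hχ' : Continuous χ') :
    IsPrimitiveOn (fun x => χ' x * V x + χ x * n x) (fun x => χ x * V x) a b := by
  have hχc : Continuous χ := continuous_iff_continuousAt.2 fun x => (hχ x).continuousAt
  have hχac : AbsolutelyContinuousOnInterval χ a b := by
    refine ContDiffOn.absolutelyContinuousOnInterval (contDiff_one_iff_deriv.2
      ⟨fun x => (hχ x).differentiableAt, ?_⟩).contDiffOn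
    rwa [funext fun x => (hχ x).deriv]
  have hint : IntervalIntegrable (fun x => χ' x * V x + χ x * n x) volume a b :=
    (hχ'.continuousOn.mul h.continuousOn).intervalIntegrable.add
      (h.intervalIntegrable.continuousOn_mul hχc.continuousOn)
  refine ⟨hint, ?_⟩
  set W : ℝ → 𝔸 := fun x => V a + ∫ t in a..x, n t
  have hW : EqOn V W (uIcc a b) := h.eq_add_integral
  obtain ⟨K, hK⟩ := ((hχac.smul h.absolutelyContinuousOnInterval).sub
    (absolutelyContinuousOnInterval_intervalIntegral hint
      left_mem_uIcc)).const_of_ae_hasDerivAt_zero (by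
    filter_upwards [h.intervalIntegrable.ae_hasDerivAt_integral, hint.ae_hasDerivAt_integral]
      with x hn hprod hx
    have hWx : HasDerivAt W (n x) x := (hn hx a left_mem_uIcc).const_add (V a)
    refine (((hχ x).mul hWx).sub (hprod hx a left_mem_uIcc)).congr_deriv ?_
    rw [hW hx, sub_self])
  intro y hy
  have hKy := hK y hy
  have hKa := hK a left_mem_uIcc
  simp only [Pi.sub_apply, smul_eq_mul, Pi.mul_apply,
    intervalIntegral.integral_same, sub_zero, add_zero] at hKy hKa
  rw [hW hy, ← sub_eq_iff_eq_add, hKa, ← hKy]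

theorem const_mul (h : IsPrimitiveOn n V a b) (c : 𝔸) :
    IsPrimitiveOn (fun x => c * n x) (fun x => c * V x) a b :=
  (h.mul_left (fun x => hasDerivAt_const x c) continuous_const).congr
    (.of_forall fun x _ => by simp) fun _ _ => rfl

end IsPrimitiveOn

end Primitive

/-! ### The initial value problem on an interval -/

/-- The solution of `-w'' = z w` with `w 0 = 1`, `w' 0 = 0`. -/
def csol (z : ℂ) (x : ℝ) : ℂ := Complex.cos (z ^ (2⁻¹ : ℂ) * x)

/-- The solution of `-w'' = z w` with `w 0 = 0`, `w' 0 = 1`. -/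
def ssol (z : ℂ) (x : ℝ) : ℂ :=
  if z = 0 then x else Complex.sin (z ^ (2⁻¹ : ℂ) * x) / z ^ (2⁻¹ : ℂ)

@[simp] theorem csol_zero (z : ℂ) : csol z 0 = 1 := by simp [csol]

@[simp] theorem ssol_zero (z : ℂ) : ssol z 0 = 0 := by simp [ssol]

theorem csol_eq_cos {z k : ℂ} (h : k ^ 2 = z) (x : ℝ) : csol z x = Complex.cos (k * x) := by
  rcases sq_eq_sq_iff_eq_or_eq_neg.1 ((Complex.cpow_ofNat_inv_pow z 2).trans h.symm) with
    hroot | hroot <;> simp [csol, hroot]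

theorem mul_ssol_eq_sin {z k : ℂ} (h : k ^ 2 = z) (x : ℝ) :
    k * ssol z x = Complex.sin (k * x) := by
  rcases eq_or_ne z 0 with rfl | hz
  · simp [pow_eq_zero_iff two_ne_zero |>.1 h]
  · have hk : k ≠ 0 := fun hk => hz (by rw [← h, hk, zero_pow two_ne_zero])
    rcases sq_eq_sq_iff_eq_or_eq_neg.1 ((Complex.cpow_ofNat_inv_pow z 2).trans h.symm)
      with hroot | hroot <;> rw [ssol, if_neg hz, hroot]
    · rw [mul_div_cancel₀ _ hk]
    · rw [neg_mul, Complex.sin_neg, neg_div_neg_eq, mul_div_cancel₀ _ hk]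

theorem csol_sq_add (z : ℂ) (x : ℝ) : csol z x ^ 2 + z * ssol z x ^ 2 = 1 := by
  have hroot := Complex.cpow_ofNat_inv_pow z 2
  rw [csol_eq_cos hroot]
  nth_rw 2 [← hroot]
  rw [← mul_pow, mul_ssol_eq_sin hroot, Complex.cos_sq_add_sin_sq]

theorem hasDerivAt_csol (z : ℂ) (x : ℝ) : HasDerivAt (csol z) (-(z * ssol z x)) x := by
  have hroot := Complex.cpow_ofNat_inv_pow z 2
  refine ((hasDerivAt_id (x : ℂ)).const_mul (z ^ (2⁻¹ : ℂ))).ccos.comp_ofReal.congr_deriv ?_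
  rw [id, ← mul_ssol_eq_sin hroot]
  linear_combination -ssol z x * hroot

theorem hasDerivAt_ssol (z : ℂ) (x : ℝ) : HasDerivAt (ssol z) (csol z x) x := by
  rcases eq_or_ne z 0 with rfl | hz
  · have hid : ssol 0 = fun t : ℝ => (t : ℂ) := by
      funext t
      simp [ssol]
    rw [hid]
    exact (hasDerivAt_id x).ofReal_comp.congr_deriv (by simp [csol])
  · have hroot : z ^ (2⁻¹ : ℂ) ≠ 0 := by simp [Complex.cpow_eq_zero_iff, hz]
    have hsin : ssol z = fun t : ℝ => Complex.sin (z ^ (2⁻¹ : ℂ) * t) / z ^ (2⁻¹ : ℂ) := by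
      funext t
      simp [ssol, hz]
    rw [hsin]
    refine (((hasDerivAt_id (x : ℂ)).const_mul (z ^ (2⁻¹ : ℂ))).csin.div_const
      (z ^ (2⁻¹ : ℂ))).comp_ofReal.congr_deriv ?_
    simp [csol, hroot]

@[fun_prop]
theorem continuous_csol (z : ℂ) : Continuous (csol z) :=
  continuous_iff_continuousAt.2 fun x => (hasDerivAt_csol z x).continuousAt

@[fun_prop]
theorem continuous_ssol (z : ℂ) : Continuous (ssol z) :=
  continuous_iff_continuousAt.2 fun x => (hasDerivAt_ssol z x).continuousAt

/-- On the interval with end points `a` and `b`, the function `w` is an `H²`-type solution of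
`-w'' = z w + h` and `w'` is its derivative. -/
structure SolvesOn (z : ℂ) (h w w' : ℝ → ℂ) (a b : ℝ) : Prop where
  value : IsPrimitiveOn w' w a b
  deriv : IsPrimitiveOn (fun x => -(z * w x + h x)) w' a b

section SolvesOn

variable {z : ℂ} {h w w' : ℝ → ℂ} {a b y : ℝ}

theorem hasDerivAt_csol_sub (z : ℂ) (y x : ℝ) :
    HasDerivAt (fun t => csol z (y - t)) (z * ssol z (y - x)) x :=
  ((hasDerivAt_csol z (y - x)).scomp x ((hasDerivAt_id x).const_sub y)).congr_deriv (by simp)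

theorem hasDerivAt_ssol_sub (z : ℂ) (y x : ℝ) :
    HasDerivAt (fun t => ssol z (y - t)) (-csol z (y - x)) x :=
  ((hasDerivAt_ssol z (y - x)).scomp x ((hasDerivAt_id x).const_sub y)).congr_deriv (by simp)

theorem SolvesOn.value_eq (hw : SolvesOn z h w w' a b) (hy : y ∈ uIcc a b) :
    w y = w a * csol z (y - a) + w' a * ssol z (y - a) - ∫ t in a..y, h t * ssol z (y - t) := by
  have hwronskian : IsPrimitiveOn (fun t => -(h t * ssol z (y - t)))
      (fun t => csol z (y - t) * w t + ssol z (y - t) * w' t) a b :=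
    ((hw.value.mul_left (hasDerivAt_csol_sub z y) (by fun_prop)).add
      (hw.deriv.mul_left (hasDerivAt_ssol_sub z y) (by fun_prop))).congr
      (.of_forall fun x _ => by ring) fun _ _ => rfl
  have hend := hwronskian.eq_add_integral y hy
  simp only [sub_self, csol_zero, ssol_zero, intervalIntegral.integral_neg] at hend
  linear_combination hend

theorem SolvesOn.deriv_eq (hw : SolvesOn z h w w' a b) (hy : y ∈ uIcc a b) :
    w' y = -(z * w a * ssol z (y - a)) + w' a * csol z (y - a)
      - ∫ t in a..y, h t * csol z (y - t) := by
  have hwronskian : IsPrimitiveOn (fun t => -(h t * csol z (y - t)))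
      (fun t => -z * (ssol z (y - t) * w t) + csol z (y - t) * w' t) a b :=
    (((hw.value.mul_left (hasDerivAt_ssol_sub z y) (by fun_prop)).const_mul (-z)).add
      (hw.deriv.mul_left (hasDerivAt_csol_sub z y) (by fun_prop))).congr
      (.of_forall fun x _ => by ring) fun _ _ => rfl
  have hend := hwronskian.eq_add_integral y hy
  simp only [sub_self, csol_zero, ssol_zero, intervalIntegral.integral_neg] at hend
  linear_combination hend

/-- Variation of constants. -/
theorem exists_solvesOn (z w₀ w₁ : ℂ) (hh : IntervalIntegrable h volume a b) :
    ∃ w w' : ℝ → ℂ, SolvesOn z h w w' a b ∧ w a = w₀ ∧ w' a = w₁ := by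
  have hc : ∀ x, HasDerivAt (fun t => csol z (t - a)) (-(z * ssol z (x - a))) x := fun x =>
    (hasDerivAt_csol z (x - a)).comp_sub_const x a
  have hs : ∀ x, HasDerivAt (fun t => ssol z (t - a)) (csol z (x - a)) x := fun x =>
    (hasDerivAt_ssol z (x - a)).comp_sub_const x a
  have h₀ := IsPrimitiveOn.const_add_integral
    (hh.mul_continuousOn (g := fun t => ssol z (t - a)) (by fun_prop)) w₀
  have h₁ := IsPrimitiveOn.const_add_integral
    (hh.mul_continuousOn (g := fun t => csol z (t - a)) (by fun_prop)).neg w₁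
  refine ⟨_, _, ⟨((h₀.mul_left hc (by fun_prop)).add (h₁.mul_left hs (by fun_prop))).congr
      (.of_forall fun x _ => ?_) fun _ _ => rfl,
    (((h₀.mul_left hs (by fun_prop)).const_mul (-z)).add (h₁.mul_left hc (by fun_prop))).congr
      (.of_forall fun x _ => ?_) fun _ _ => rfl⟩, by simp, by simp⟩
  · simp only [Pi.neg_apply]
    ring
  · simp only [Pi.neg_apply]
    linear_combination -h x * csol_sq_add z (x - a)

end SolvesOn

/-! ### The gauge transformation on an edge -/

/-- The gauge factor `exp (-i a x)`, which turns the quasiderivative into the derivative. -/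
def phase (a x : ℝ) : ℂ := Complex.exp (-(Complex.I * a * x))

@[simp] theorem phase_zero (a : ℝ) : phase a 0 = 1 := by simp [phase]

@[simp] theorem norm_phase (a x : ℝ) : ‖phase a x‖ = 1 := by
  rw [phase, show -(Complex.I * a * x) = ((-(a * x) : ℝ) : ℂ) * Complex.I by push_cast; ring]
  exact Complex.norm_exp_ofReal_mul_I _

@[simp] theorem phase_neg_mul_phase (a x : ℝ) : phase (-a) x * phase a x = 1 := by
  rw [phase, phase, ← Complex.exp_add]
  simp

theorem phase_ne_zero (a x : ℝ) : phase a x ≠ 0 := Complex.exp_ne_zero _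

theorem hasDerivAt_phase (a x : ℝ) : HasDerivAt (phase a) (-(Complex.I * a) * phase a x) x := by
  refine (((hasDerivAt_id (x : ℂ)).const_mul (Complex.I * a)).neg.cexp.comp_ofReal).congr_deriv ?_
  simp only [phase, id, Pi.neg_apply]
  ring

@[fun_prop]
theorem continuous_phase (a : ℝ) : Continuous (phase a) :=
  continuous_iff_continuousAt.2 fun x => (hasDerivAt_phase a x).continuousAt

/-- The gauge transform of `u` on the `j`-th edge, normalized at the left end point. -/
def gauge (a : ℝ) (j : ℤ) (u : ℝ → ℂ) (x : ℝ) : ℂ := phase a (x - vertex j) * u x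

@[simp] theorem gauge_vertex (a : ℝ) (j : ℤ) (u : ℝ → ℂ) :
    gauge a j u (vertex j) = u (vertex j) := by
  simp [gauge]

@[simp] theorem norm_gauge (a : ℝ) (j : ℤ) (u : ℝ → ℂ) (x : ℝ) : ‖gauge a j u x‖ = ‖u x‖ := by
  simp [gauge]

@[simp] theorem gauge_neg_gauge (a : ℝ) (j : ℤ) (u : ℝ → ℂ) : gauge (-a) j (gauge a j u) = u := by
  funext x
  simp [gauge, ← mul_assoc]

section Edge

variable {a : ℝ} {j : ℤ} {u v : ℝ → ℂ}

theorem left_mem_edge (j : ℤ) : vertex j ∈ edge j := ⟨le_rfl, (vertex_lt j).le⟩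

theorem right_mem_edge (j : ℤ) : vertex (j + 1) ∈ edge j := ⟨(vertex_lt j).le, le_rfl⟩

theorem vertex_succ_sub (j : ℤ) : vertex (j + 1) - vertex j = Real.pi := by
  rw [vertex, vertex]
  push_cast
  ring

theorem uIcc_vertex (j : ℤ) : uIcc (vertex j) (vertex (j + 1)) = edge j :=
  uIcc_of_le (vertex_lt j).le

theorem hasQuasiDeriv_iff_isPrimitiveOn :
    HasQuasiDeriv a j u v ↔ IsPrimitiveOn (fun x => v x + Complex.I * a * u x) u
      (vertex j) (vertex (j + 1)) := by
  constructor
  · exact fun h => ⟨h.integrand (right_mem_edge j), by rw [uIcc_vertex]; exact h.2.2⟩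
  · intro h
    have hu : IntervalIntegrable (fun x => Complex.I * a * u x) volume (vertex j)
        (vertex (j + 1)) := h.continuousOn.intervalIntegrable.const_mul _
    refine ⟨uIcc_vertex j ▸ h.continuousOn, ?_, uIcc_vertex j ▸ h.eq_add_integral⟩
    simpa using h.intervalIntegrable.sub hu

theorem hasQuasiDeriv_iff_gauge :
    HasQuasiDeriv a j u v ↔
      IsPrimitiveOn (gauge a j v) (gauge a j u) (vertex j) (vertex (j + 1)) := by
  rw [hasQuasiDeriv_iff_isPrimitiveOn]
  have hphase : ∀ a x, HasDerivAt (fun t => phase a (t - vertex j))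
      (-(Complex.I * a) * phase a (x - vertex j)) x := fun a x =>
    (hasDerivAt_phase a (x - vertex j)).comp_sub_const x (vertex j)
  constructor <;> intro h
  · refine (h.mul_left (hphase a) (by fun_prop)).congr (.of_forall fun x _ => ?_) fun _ _ => rfl
    rw [gauge]
    ring
  · have hinv := h.mul_left (hphase (-a)) (by fun_prop)
    refine hinv.congr (.of_forall fun x _ => ?_) fun x _ => congrFun (gauge_neg_gauge a j u) x
    rw [gauge, gauge]
    push_cast
    linear_combination (Complex.I * a * u x + v x) * phase_neg_mul_phase a (x - vertex j)

theorem solvesOn_gauge_iff {z : ℂ} {p h : ℝ → ℂ} :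
    SolvesOn z (gauge a j h) (gauge a j u) (gauge a j p) (vertex j) (vertex (j + 1)) ↔
      HasQuasiDeriv a j u p ∧ HasQuasiDeriv a j p fun x => -(z * u x + h x) := by
  rw [hasQuasiDeriv_iff_gauge, hasQuasiDeriv_iff_gauge]
  have hsource : (fun x => -(z * gauge a j u x + gauge a j h x))
      = gauge a j fun x => -(z * u x + h x) := by
    funext x
    rw [gauge, gauge, gauge]
    ring
  exact ⟨fun hw => ⟨hw.value, hsource ▸ hw.deriv⟩, fun hw => ⟨hw.1, hsource ▸ hw.2⟩⟩

theorem HasQuasiDeriv.congr_edge {v' : ℝ → ℂ} (h : HasQuasiDeriv a j u v)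
    (hv : v =ᵐ[volume.restrict (edge j)] v') : HasQuasiDeriv a j u v' := by
  rw [hasQuasiDeriv_iff_isPrimitiveOn] at h ⊢
  refine h.congr ?_ fun _ _ => rfl
  filter_upwards [(ae_restrict_iff' measurableSet_Icc).1 hv] with x hx hxm
  rw [hx ((uIcc_vertex j).le hxm)]

end Edge

/-! ### Square integrals over edges -/

theorem sq_integral_norm_le {X F : Type*} [MeasurableSpace X] {μ : Measure X} [IsFiniteMeasure μ]
    [NormedAddCommGroup F] {h : X → F} (hh : MemLp h 2 μ) :
    (∫ x, ‖h x‖ ∂μ) ^ 2 ≤ μ.real univ * ∫ x, ‖h x‖ ^ 2 ∂μ := by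
  have hholder := integral_mul_le_Lp_mul_Lq_of_nonneg (μ := μ) Real.HolderConjugate.two_two
    (.of_forall fun _ => zero_le_one) (.of_forall fun x => norm_nonneg (h x))
    (memLp_const (1 : ℝ)) (by simpa using hh.norm)
  simp only [one_mul, Real.rpow_ofNat, one_pow, integral_const, smul_eq_mul, mul_one,
    ← Real.sqrt_eq_rpow] at hholder
  have hnonneg : 0 ≤ ∫ x, ‖h x‖ ∂μ := integral_nonneg fun _ => norm_nonneg _
  have hsq := pow_le_pow_left₀ hnonneg hholder 2
  rwa [mul_pow, Real.sq_sqrt measureReal_nonneg,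
    Real.sq_sqrt (integral_nonneg fun _ => sq_nonneg _)] at hsq

/-- The square integral of `g` over the `j`-th edge. -/
def edgeSq (g : ℝ → ℂ) (j : ℤ) : ℝ := ∫ x in edge j, ‖g x‖ ^ 2

theorem measurableSet_edge (j : ℤ) : MeasurableSet (edge j) := measurableSet_Icc

theorem isCompact_edge (j : ℤ) : IsCompact (edge j) := isCompact_Icc

theorem volume_real_edge (j : ℤ) : volume.real (edge j) = Real.pi := by
  rw [edge, Real.volume_real_Icc_of_le (vertex_lt j).le, vertex_succ_sub]

instance isFiniteMeasure_restrict_edge (j : ℤ) : IsFiniteMeasure (volume.restrict (edge j)) :=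
  isFiniteMeasure_restrict.2 (isCompact_edge j).measure_lt_top.ne

theorem restrict_edge_eq_restrict_Ico (j : ℤ) :
    volume.restrict (edge j) = volume.restrict (Ico (vertex j) (vertex (j + 1))) :=
  Measure.restrict_congr_set Ico_ae_eq_Icc.symm

theorem iUnion_Ico_vertex : ⋃ j : ℤ, Ico (vertex j) (vertex (j + 1)) = univ := by
  simpa [vertex] using iUnion_Ico_zsmul Real.pi_pos

theorem pairwise_disjoint_Ico_vertex :
    Pairwise (Function.onFun Disjoint fun j : ℤ => Ico (vertex j) (vertex (j + 1))) := by
  simpa [vertex] using pairwise_disjoint_Ico_zsmul Real.pi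

section EdgeSq

variable {g h : ℝ → ℂ} {j : ℤ} {M : ℝ}

theorem edgeSq_nonneg (g : ℝ → ℂ) (j : ℤ) : 0 ≤ edgeSq g j := integral_nonneg fun _ => sq_nonneg _

theorem edgeSq_congr (hgh : g =ᵐ[volume.restrict (edge j)] h) : edgeSq g j = edgeSq h j :=
  integral_congr_ae (hgh.fun_comp fun y => ‖y‖ ^ 2)

theorem edgeSq_le_of_bound (hM : ∀ x ∈ edge j, ‖g x‖ ^ 2 ≤ M) : edgeSq g j ≤ Real.pi * M := by
  rw [edgeSq, ← volume_real_edge j, mul_comm]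
  refine (Real.norm_of_nonneg (edgeSq_nonneg g j)).symm.trans_le ?_
  refine norm_setIntegral_le_of_norm_le_const (isCompact_edge j).measure_lt_top fun x hx => ?_
  rw [Real.norm_of_nonneg (sq_nonneg _)]
  exact hM x hx

theorem sq_integral_edge_le (hg : MemLp g 2 (volume.restrict (edge j))) :
    (∫ x in edge j, ‖g x‖) ^ 2 ≤ Real.pi * edgeSq g j := by
  have hjensen := sq_integral_norm_le hg
  rwa [measureReal_restrict_apply_univ, volume_real_edge] at hjensen

theorem intervalIntegrable_of_integrableOn_edge (hg : IntegrableOn g (edge j)) :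
    IntervalIntegrable g volume (vertex j) (vertex (j + 1)) :=
  (intervalIntegrable_iff_integrableOn_Icc_of_le (vertex_lt j).le).2 hg

theorem memLp_edge (f : Lp ℂ 2 (volume : Measure ℝ)) (j : ℤ) :
    MemLp f 2 (volume.restrict (edge j)) :=
  (Lp.memLp f).restrict (edge j)

theorem integrableOn_edge (f : Lp ℂ 2 (volume : Measure ℝ)) (j : ℤ) : IntegrableOn f (edge j) :=
  (memLp_edge f j).integrable one_le_two

theorem hasSum_edgeSq_lp (f : Lp ℂ 2 (volume : Measure ℝ)) :
    HasSum (fun j => edgeSq f j) (‖f‖ ^ 2) := by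
  have hint : Integrable (fun x => ‖f x‖ ^ 2) :=
    (memLp_two_iff_integrable_sq_norm (Lp.memLp f).1).1 (Lp.memLp f)
  have hnorm : ‖f‖ ^ 2 = ∫ x, ‖f x‖ ^ 2 := by
    have hinner := congrArg RCLike.re (L2.inner_def (𝕜 := ℂ) f f)
    rw [inner_self_eq_norm_sq, ← integral_re (L2.integrable_inner f f)] at hinner
    simpa only [inner_self_eq_norm_sq] using hinner
  have hsum := hasSum_integral_iUnion (fun j : ℤ => measurableSet_Ico)
    pairwise_disjoint_Ico_vertex hint.integrableOn
  rw [iUnion_Ico_vertex, Measure.restrict_univ, ← hnorm] at hsum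
  simpa only [edgeSq, restrict_edge_eq_restrict_Ico] using hsum

theorem hasSum_edgeSq (f : L2Graph) : HasSum (fun j => ∑ s, edgeSq (f s) j) (‖f‖ ^ 2) := by
  rw [PiLp.norm_sq_eq_of_L2]
  exact hasSum_sum fun s _ => hasSum_edgeSq_lp (f s)

theorem summable_edgeSq (f : L2Graph) (s : Fin 2) : Summable fun j => edgeSq (f s) j :=
  (hasSum_edgeSq_lp (f s)).summable

end EdgeSq

/-! ### Gluing functions given on the edges -/

/-- The function on `ℝ` that agrees with `u j` on the `j`-th edge without its right end point. -/
def glue (u : ℤ → ℝ → ℂ) (x : ℝ) : ℂ := u ⌊x / Real.pi⌋ x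

section Glue

variable {u : ℤ → ℝ → ℂ} {M : ℤ → ℝ}

theorem glue_eqOn (u : ℤ → ℝ → ℂ) (j : ℤ) :
    EqOn (glue u) (u j) (Ico (vertex j) (vertex (j + 1))) := by
  rintro x ⟨hleft, hright⟩
  have hfloor : ⌊x / Real.pi⌋ = j := by
    rw [Int.floor_eq_iff, le_div_iff₀ Real.pi_pos, div_lt_iff₀ Real.pi_pos]
    exact ⟨hleft, by simpa [vertex] using hright⟩
  rw [glue, hfloor]

theorem glue_ae_eq (u : ℤ → ℝ → ℂ) (j : ℤ) : glue u =ᵐ[volume.restrict (edge j)] u j := by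
  rw [restrict_edge_eq_restrict_Ico]
  exact (ae_restrict_iff' measurableSet_Ico).2 (.of_forall fun x hx => glue_eqOn u j hx)

theorem aestronglyMeasurable_glue (hu : ∀ j, ContinuousOn (u j) (edge j)) :
    AEStronglyMeasurable (glue u) := by
  rw [← Measure.restrict_univ (μ := volume), ← iUnion_Ico_vertex, aestronglyMeasurable_iUnion_iff]
  intro j
  rw [← restrict_edge_eq_restrict_Ico]
  exact ((hu j).aestronglyMeasurable (measurableSet_edge j)).congr (glue_ae_eq u j).symm

theorem memLp_glue (hu : ∀ j, ContinuousOn (u j) (edge j)) (hM : Summable M)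
    (huM : ∀ j, ∀ x ∈ edge j, ‖u j x‖ ^ 2 ≤ M j) : MemLp (glue u) 2 := by
  rw [memLp_two_iff_integrable_sq_norm (aestronglyMeasurable_glue hu), ← integrableOn_univ,
    ← iUnion_Ico_vertex]
  refine integrableOn_iUnion_of_summable_integral_norm (fun j => ?_) ?_
  · have hint : IntegrableOn (fun x => ‖u j x‖ ^ 2) (edge j) :=
      ((hu j).norm.pow 2).integrableOn_compact (isCompact_edge j)
    rw [IntegrableOn, ← restrict_edge_eq_restrict_Ico]
    exact hint.congr ((glue_ae_eq u j).symm.fun_comp fun y => ‖y‖ ^ 2)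
  · simp only [← restrict_edge_eq_restrict_Ico, norm_pow, norm_norm]
    refine .of_nonneg_of_le (fun j => edgeSq_nonneg (glue u) j) (fun j => ?_)
      (hM.mul_left Real.pi)
    exact (edgeSq_congr (glue_ae_eq u j)).trans_le (edgeSq_le_of_bound (huM j))

end Glue

/-! ### Estimates for solutions on an edge -/

section Estimates

variable {a y : ℝ} {j : ℤ} {u p g h : ℝ → ℂ}

theorem norm_integral_mul_le {m χ : ℝ → ℂ} {K : ℝ} (hm : IntegrableOn m (edge j))
    (hy : y ∈ edge j) (hχ : ∀ t ∈ Icc (vertex j) y, ‖χ t‖ ≤ K) :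
    ‖∫ t in vertex j..y, m t * χ t‖ ≤ K * ∫ t in edge j, ‖m t‖ := by
  have hK : 0 ≤ K := (norm_nonneg _).trans (hχ y ⟨hy.1, le_rfl⟩)
  have hmK : IntegrableOn (fun t => K * ‖m t‖) (edge j) := hm.norm.const_mul K
  have hsub : Ioc (vertex j) y ⊆ edge j := fun t ht => ⟨ht.1.le, ht.2.trans hy.2⟩
  rw [intervalIntegral.integral_of_le hy.1, ← integral_const_mul]
  refine (norm_integral_le_of_norm_le (hmK.mono_set hsub) ?_).trans
    (setIntegral_mono_set hmK (.of_forall fun t => mul_nonneg hK (norm_nonneg _))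
      hsub.eventuallyLE)
  filter_upwards [ae_restrict_mem measurableSet_Ioc] with t ht
  rw [norm_mul, mul_comm]
  exact mul_le_mul_of_nonneg_right (hχ t (Ioc_subset_Icc_self ht)) (norm_nonneg _)

theorem sub_mem_Icc_pi {t : ℝ} (hy : y ∈ edge j) (ht : t ∈ Icc (vertex j) y) :
    y - t ∈ Icc 0 Real.pi := by
  rw [← vertex_succ_sub j]
  exact ⟨sub_nonneg.2 ht.2, sub_le_sub hy.2 ht.1⟩

theorem integrableOn_gauge (hh : IntegrableOn h (edge j)) (a : ℝ) :
    IntegrableOn (gauge a j h) (edge j) :=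
  hh.continuousOn_mul (g := fun x => phase a (x - vertex j)) (by fun_prop) (isCompact_edge j)

theorem memLp_of_continuousOn (hu : ContinuousOn u (edge j)) :
    MemLp u 2 (volume.restrict (edge j)) :=
  (memLp_two_iff_integrable_sq_norm (hu.aestronglyMeasurable (measurableSet_edge j))).2
    ((hu.norm.pow 2).integrableOn_compact (isCompact_edge j))

theorem exists_norm_csol_ssol_le (z : ℂ) :
    ∃ K : ℝ, ∀ x ∈ Icc 0 Real.pi, ‖csol z x‖ ≤ K ∧ ‖ssol z x‖ ≤ K := by
  obtain ⟨K, hK⟩ := isCompact_Icc.exists_bound_of_continuousOn (s := Icc 0 Real.pi)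
    (f := fun x => (csol z x, ssol z x)) (by fun_prop)
  exact ⟨K, fun x hx => norm_prod_le_iff.1 (hK x hx)⟩

theorem norm_solution_le {z : ℂ} {K : ℝ}
    (hK : ∀ x ∈ Icc 0 Real.pi, ‖csol z x‖ ≤ K ∧ ‖ssol z x‖ ≤ K) (hu : HasQuasiDeriv a j u p)
    (hp : HasQuasiDeriv a j p fun x => -(z * u x + h x)) (hh : IntegrableOn h (edge j))
    (hy : y ∈ edge j) :
    ‖u y‖ ≤ K * (‖u (vertex j)‖ + ‖p (vertex j)‖ + ∫ x in edge j, ‖h x‖) := by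
  have hvalue := (solvesOn_gauge_iff.2 ⟨hu, hp⟩).value_eq ((uIcc_vertex j).symm ▸ hy)
  have hends := hK _ (sub_mem_Icc_pi hy (left_mem_Icc.2 hy.1))
  have hsource := norm_integral_mul_le (χ := fun t => ssol z (y - t)) (integrableOn_gauge hh a) hy
    fun t ht => (hK _ (sub_mem_Icc_pi hy ht)).2
  simp only [gauge_vertex, norm_gauge] at hvalue hsource
  calc ‖u y‖ = ‖gauge a j u y‖ := (norm_gauge a j u y).symm
    _ ≤ ‖u (vertex j)‖ * ‖csol z (y - vertex j)‖ + ‖p (vertex j)‖ * ‖ssol z (y - vertex j)‖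
        + ‖∫ t in vertex j..y, gauge a j h t * ssol z (y - t)‖ := by
      rw [hvalue, ← norm_mul, ← norm_mul]
      exact (norm_sub_le _ _).trans (add_le_add_left (norm_add_le _ _) _)
    _ ≤ ‖u (vertex j)‖ * K + ‖p (vertex j)‖ * K + K * ∫ x in edge j, ‖h x‖ := by
      gcongr
      exacts [hends.1, hends.2]
    _ = _ := by ring

theorem exists_sq_solution_le (z : ℂ) :
    ∃ K : ℝ, 0 ≤ K ∧ ∀ {a : ℝ} {j : ℤ} {u p h : ℝ → ℂ}, HasQuasiDeriv a j u p →
      (HasQuasiDeriv a j p fun x => -(z * u x + h x)) → MemLp h 2 (volume.restrict (edge j)) →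
      ∀ x ∈ edge j, ‖u x‖ ^ 2 ≤ K * (‖u (vertex j)‖ ^ 2 + ‖p (vertex j)‖ ^ 2 + edgeSq h j) := by
  obtain ⟨K, hK⟩ := exists_norm_csol_ssol_le z
  refine ⟨3 * Real.pi * K ^ 2, by positivity, fun {a j u p h} hu hp hh y hy => ?_⟩
  have hlinear := norm_solution_le hK hu hp (hh.integrable one_le_two) hy
  have hsource := sq_integral_edge_le hh
  set U := ‖u (vertex j)‖
  set P := ‖p (vertex j)‖
  set I := ∫ x in edge j, ‖h x‖
  have hUP : U ^ 2 + P ^ 2 ≤ Real.pi * (U ^ 2 + P ^ 2) :=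
    le_mul_of_one_le_left (by positivity) (by linarith [Real.pi_gt_three])
  calc ‖u y‖ ^ 2 ≤ K ^ 2 * (U + P + I) ^ 2 := by rw [← mul_pow]; gcongr
    _ ≤ K ^ 2 * (3 * (U ^ 2 + P ^ 2 + I ^ 2)) := by
      gcongr
      linarith [sq_nonneg (U - P), sq_nonneg (U - I), sq_nonneg (P - I)]
    _ ≤ K ^ 2 * (3 * (Real.pi * (U ^ 2 + P ^ 2) + Real.pi * edgeSq h j)) := by gcongr
    _ = _ := by ring

/-- Integrate `χ w'' - χ'' w = (χ w' - χ' w)'` for the cubic `χ t = (t - a) (b - t) ^ 2`. -/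
theorem sq_mul_left_eq_integral {b : ℝ} {w w' : ℝ → ℂ} (hw : IsPrimitiveOn w' w a b)
    (hw' : IsPrimitiveOn g w' a b) :
    ((b : ℂ) - a) ^ 2 * w a
      = ∫ t in a..b, (g t * ((t - a) * (b - t) ^ 2) + w t * (4 * b + 2 * a - 6 * t)) := by
  have hid : ∀ t : ℝ, HasDerivAt (fun t : ℝ => (t : ℂ)) 1 t := fun t =>
    (hasDerivAt_id t).ofReal_comp
  have hχ : ∀ t : ℝ, HasDerivAt (fun t : ℝ => ((t : ℂ) - a) * (b - t) ^ 2)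
      ((b - t) ^ 2 - 2 * (t - a) * (b - t)) t := fun t =>
    (((hid t).sub_const (a : ℂ)).mul (((hid t).const_sub (b : ℂ)).pow 2)).congr_deriv (by
      simp only [Pi.pow_apply]
      ring)
  have hχ' : ∀ t : ℝ, HasDerivAt (fun t : ℝ => 2 * ((t : ℂ) - a) * (b - t) - (b - t) ^ 2)
      (4 * b + 2 * a - 6 * t : ℂ) t := fun t =>
    (((((hid t).sub_const (a : ℂ)).const_mul 2).mul ((hid t).const_sub (b : ℂ))).sub
      (((hid t).const_sub (b : ℂ)).pow 2)).congr_deriv (by ring)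
  have hprim := ((hw'.mul_left hχ (by fun_prop)).add (hw.mul_left hχ' (by fun_prop))).congr
    (m' := fun t => g t * ((t - a) * (b - t) ^ 2) + w t * (4 * b + 2 * a - 6 * t))
    (.of_forall fun t _ => by ring) fun _ _ => rfl
  have hend := hprim.eq_add_integral b right_mem_uIcc
  simp only [sub_self] at hend
  linear_combination hend

theorem pi_mul_norm_vertex_le (hu : HasQuasiDeriv a j u p)
    (hp : HasQuasiDeriv a j p g) (hg : IntegrableOn g (edge j)) :
    Real.pi * ‖u (vertex j)‖ ≤ 4 * (∫ x in edge j, ‖u x‖) + Real.pi ^ 2 * ∫ x in edge j, ‖g x‖ := by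
  have hπ := Real.pi_pos
  have hsub : ((vertex (j + 1) : ℂ) - vertex j) = Real.pi := by
    rw [← vertex_succ_sub j, Complex.ofReal_sub]
  have hug := integrableOn_gauge (hu.1.integrableOn_compact (isCompact_edge j)) a
  have hgg := integrableOn_gauge hg a
  have hvalue := sq_mul_left_eq_integral (hasQuasiDeriv_iff_gauge.1 hu)
    (hasQuasiDeriv_iff_gauge.1 hp)
  rw [intervalIntegral.integral_add
    ((intervalIntegrable_of_integrableOn_edge hgg).mul_continuousOn (by fun_prop))
    ((intervalIntegrable_of_integrableOn_edge hug).mul_continuousOn (by fun_prop)),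
    gauge_vertex, hsub] at hvalue
  have hcubic := norm_integral_mul_le (K := Real.pi ^ 3) hgg (right_mem_edge j)
    (χ := fun t => (t - vertex j) * (vertex (j + 1) - t) ^ 2) fun t ht => by
      have hlen := vertex_succ_sub j
      rw [← Complex.ofReal_sub, ← Complex.ofReal_sub, norm_mul, norm_pow, Complex.norm_of_nonneg
        (sub_nonneg.2 ht.1), Complex.norm_of_nonneg (sub_nonneg.2 ht.2), pow_succ' _ 2]
      have := sub_nonneg.2 ht.2
      gcongr <;> linarith [ht.1, ht.2]
  have hlinear := norm_integral_mul_le (K := 4 * Real.pi) hug (right_mem_edge j)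
    (χ := fun t => 4 * vertex (j + 1) + 2 * vertex j - 6 * t) fun t ht => by
      have hlen := vertex_succ_sub j
      rw [show (4 * vertex (j + 1) + 2 * vertex j - 6 * t : ℂ)
        = ((4 * vertex (j + 1) + 2 * vertex j - 6 * t : ℝ) : ℂ) by push_cast; ring,
        Complex.norm_real, Real.norm_eq_abs, abs_le]
      constructor <;> linarith [ht.1, ht.2]
  simp only [norm_gauge] at hcubic hlinear
  refine le_of_mul_le_mul_left ?_ hπ
  calc Real.pi * (Real.pi * ‖u (vertex j)‖) = ‖(Real.pi : ℂ) ^ 2 * u (vertex j)‖ := by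
        rw [norm_mul, norm_pow, Complex.norm_of_nonneg hπ.le]
        ring
    _ ≤ Real.pi ^ 3 * (∫ x in edge j, ‖g x‖) + 4 * Real.pi * ∫ x in edge j, ‖u x‖ :=
      hvalue ▸ (norm_add_le _ _).trans (add_le_add hcubic hlinear)
    _ = _ := by ring

theorem sq_norm_vertex_le (hu : HasQuasiDeriv a j u p) (hp : HasQuasiDeriv a j p g)
    (hg : MemLp g 2 (volume.restrict (edge j))) :
    ‖u (vertex j)‖ ^ 2 ≤ 32 * Real.pi ^ 3 * (edgeSq u j + edgeSq g j) := by
  have hπ := Real.pi_gt_three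
  have hlinear := pi_mul_norm_vertex_le hu hp (hg.integrable one_le_two)
  have hI := sq_integral_edge_le (memLp_of_continuousOn hu.1)
  have hJ := sq_integral_edge_le hg
  set I := ∫ x in edge j, ‖u x‖
  set J := ∫ x in edge j, ‖g x‖
  have hI₀ : 0 ≤ I := integral_nonneg fun _ => norm_nonneg _
  have hJ₀ : 0 ≤ J := integral_nonneg fun _ => norm_nonneg _
  have hnorm : ‖u (vertex j)‖ ≤ 4 * Real.pi * (I + J) := by
    nlinarith [mul_nonneg Real.pi_pos.le hI₀, mul_nonneg Real.pi_pos.le hJ₀]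
  calc ‖u (vertex j)‖ ^ 2 ≤ (4 * Real.pi * (I + J)) ^ 2 := by gcongr
    _ ≤ 16 * Real.pi ^ 2 * (2 * (I ^ 2 + J ^ 2)) := by
      rw [mul_pow, mul_pow]
      norm_num only
      gcongr
      exact add_sq_le
    _ ≤ 16 * Real.pi ^ 2 * (2 * (Real.pi * edgeSq u j + Real.pi * edgeSq g j)) := by gcongr
    _ = _ := by ring

end Estimates

/-! ### Moments of the source -/

/-- The integral over the `j`-th edge of the gauged component `s` of `h` against the profile `χ`,
reflected so that its origin is the right end of the edge. -/
def moment (A : ℝ) (χ : ℝ → ℂ) (s : Fin 2) (j : ℤ) (h : L2Graph) : ℂ :=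
  ∫ t in vertex j..vertex (j + 1), gauge (potential A s) j (h s) t * χ (vertex (j + 1) - t)

section Moment

variable {χ : ℝ → ℂ}

theorem intervalIntegrable_moment (A : ℝ) (hχ : Continuous χ) (s : Fin 2) (j : ℤ) (h : L2Graph) :
    IntervalIntegrable (fun t => gauge (potential A s) j (h s) t * χ (vertex (j + 1) - t)) volume
      (vertex j) (vertex (j + 1)) :=
  (intervalIntegrable_of_integrableOn_edge (integrableOn_gauge (integrableOn_edge (h s) j)
    _)).mul_continuousOn (by fun_prop)

theorem moment_add (A : ℝ) (hχ : Continuous χ) (s : Fin 2) (j : ℤ) (h h' : L2Graph) :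
    moment A χ s j (h + h') = moment A χ s j h + moment A χ s j h' := by
  rw [moment, moment, moment, ← intervalIntegral.integral_add
    (intervalIntegrable_moment A hχ s j h) (intervalIntegrable_moment A hχ s j h')]
  refine intervalIntegral.integral_congr_ae ?_
  filter_upwards [Lp.coeFn_add (h s) (h' s)] with t ht _
  simp only [gauge, PiLp.add_apply, ht, Pi.add_apply]
  ring

theorem moment_smul (A : ℝ) (χ : ℝ → ℂ) (s : Fin 2) (j : ℤ) (c : ℂ) (h : L2Graph) :
    moment A χ s j (c • h) = c * moment A χ s j h := by
  rw [moment, moment, ← intervalIntegral.integral_const_mul]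
  refine intervalIntegral.integral_congr_ae ?_
  filter_upwards [Lp.coeFn_smul c (h s)] with t ht _
  simp only [gauge, PiLp.smul_apply, ht, Pi.smul_apply, smul_eq_mul]
  ring

theorem exists_sq_moment_le (hχ : Continuous χ) :
    ∃ K : ℝ, 0 ≤ K ∧ ∀ (A : ℝ) (s : Fin 2) (j : ℤ) (h : L2Graph),
      ‖moment A χ s j h‖ ^ 2 ≤ K * edgeSq (h s) j := by
  obtain ⟨K, hK⟩ := isCompact_Icc.exists_bound_of_continuousOn
    hχ.continuousOn (s := Icc 0 Real.pi)
  refine ⟨K ^ 2 * Real.pi, by positivity, fun A s j h => ?_⟩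
  have hlinear : ‖moment A χ s j h‖ ≤ K * ∫ x in edge j, ‖h s x‖ := by
    simpa only [moment, norm_gauge] using norm_integral_mul_le
      (integrableOn_gauge (integrableOn_edge (h s) j) (potential A s)) (right_mem_edge j)
      fun t ht => hK _ (sub_mem_Icc_pi (right_mem_edge j) ht)
  calc ‖moment A χ s j h‖ ^ 2 ≤ K ^ 2 * (∫ x in edge j, ‖h s x‖) ^ 2 := by
        rw [← mul_pow]
        gcongr
    _ ≤ K ^ 2 * (Real.pi * edgeSq (h s) j) := by
        gcongr
        exact sq_integral_edge_le (memLp_edge (h s) j)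
    _ = _ := by ring

end Moment

/-! ### The sequence space and the Jacobi operator -/

/-- The Hilbert space of square summable sequences of vertex values. -/
abbrev Seq : Type := lp (fun _ : ℤ => ℂ) 2

theorem memℓp_two_iff {ι E : Type*} [NormedAddCommGroup E] {b : ι → E} :
    Memℓp b 2 ↔ Summable fun j => ‖b j‖ ^ 2 := by
  simpa using memℓp_gen_iff (f := b) (p := 2) (by norm_num)

namespace Seq

theorem hasSum_norm_sq (x : Seq) : HasSum (fun j => ‖x j‖ ^ 2) (‖x‖ ^ 2) := by
  simpa using lp.hasSum_norm (p := 2) (by norm_num) x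

/-- The element of `ℓ²(ℤ)` with the given square summable terms. -/
def mk (b : ℤ → ℂ) (hb : Summable fun j => ‖b j‖ ^ 2) : Seq := ⟨b, memℓp_two_iff.2 hb⟩

@[simp] theorem mk_apply (b : ℤ → ℂ) (hb : Summable fun j => ‖b j‖ ^ 2) (j : ℤ) :
    mk b hb j = b j := rfl

theorem add_apply (x y : Seq) (j : ℤ) : (x + y) j = x j + y j := rfl

theorem smul_apply (c : ℂ) (x : Seq) (j : ℤ) : (c • x) j = c * x j := rfl

end Seq

theorem hasSum_norm_sq_shift (n : ℤ) (x : Seq) : HasSum (fun j => ‖x (j + n)‖ ^ 2) (‖x‖ ^ 2) :=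
  ((Equiv.addRight n).hasSum_iff (f := fun j => ‖x j‖ ^ 2)).2 x.hasSum_norm_sq

/-- The shift of sequences by `n`. -/
def shift (n : ℤ) : Seq →ₗᵢ[ℂ] Seq where
  toFun x := Seq.mk (fun j => x (j + n)) (hasSum_norm_sq_shift n x).summable
  map_add' _ _ := rfl
  map_smul' _ _ := rfl
  norm_map' x := (sq_eq_sq₀ (norm_nonneg _) (norm_nonneg _)).1
    ((Seq.hasSum_norm_sq _).unique (hasSum_norm_sq_shift n x))

@[simp] theorem shift_apply (n : ℤ) (x : Seq) (j : ℤ) : shift n x j = x (j + n) := rfl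

theorem adjoint_shift (n : ℤ) :
    ContinuousLinearMap.adjoint (shift n).toContinuousLinearMap
      = (shift (-n)).toContinuousLinearMap := by
  symm
  rw [ContinuousLinearMap.eq_adjoint_iff]
  intro x y
  rw [lp.inner_eq_tsum, lp.inner_eq_tsum, ← (Equiv.addRight n).tsum_eq]
  simp

/-- The nearest neighbour hopping operator of strength `c`. -/
def hopping (c : ℝ) : Seq →L[ℂ] Seq :=
  (c : ℂ) • ((shift 1).toContinuousLinearMap + (shift (-1)).toContinuousLinearMap)

theorem isSelfAdjoint_hopping (c : ℝ) : IsSelfAdjoint (hopping c) := by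
  rw [hopping, ContinuousLinearMap.isSelfAdjoint_iff', map_smulₛₗ, map_add, adjoint_shift,
    adjoint_shift, neg_neg, add_comm, Complex.conj_ofReal]

instance : Nontrivial Seq :=
  ⟨⟨lp.single 2 0 1, 0, fun h => by
    simpa using congrArg (fun x : Seq => x 0) h⟩⟩

theorem norm_hopping_le (c : ℝ) : ‖hopping c‖ ≤ 2 * |c| := by
  rw [hopping, norm_smul, Complex.norm_real, Real.norm_eq_abs, mul_comm]
  gcongr
  exact (norm_add_le_of_le (shift 1).norm_toContinuousLinearMap_le
    (shift (-1)).norm_toContinuousLinearMap_le).trans_eq one_add_one_eq_two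

/-- The projection onto the coordinate of the impurity. -/
def proj : Seq →L[ℂ] Seq :=
  (lp.singleContinuousLinearMap ℂ (fun _ : ℤ => ℂ) 2 1).comp (lp.evalCLM ℂ (fun _ : ℤ => ℂ) 2 1)

theorem proj_apply (x : Seq) : proj x = lp.single 2 1 (x 1) := rfl

theorem proj_apply_apply (x : Seq) (j : ℤ) : proj x j = if j = 1 then x 1 else 0 := by
  rw [proj_apply, lp.single_apply]
  exact Pi.single_apply (1 : ℤ) (x 1) j

/-- The value at the end of an edge of the solution of `-w'' = z w` with `w 0 = 1`, `w' 0 = 0`. -/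
def cosEnd (z : ℂ) : ℂ := csol z Real.pi

/-- The value at the end of an edge of the solution of `-w'' = z w` with `w 0 = 0`, `w' 0 = 1`;
its zeros are the Dirichlet energies of an edge. -/
def sinEnd (z : ℂ) : ℂ := ssol z Real.pi

/-- One half of the trace of the transfer matrix of the chain in the absence of the field. -/
def discr (α : ℝ) (z : ℂ) : ℂ := cosEnd z + α / 4 * sinEnd z

/-- The Jacobi operator satisfied by the vertex values of the solutions at energy `z`, for the
coupling `α` with an additional impurity `γ` at the vertex number `1`. -/
def jacobi (A α γ : ℝ) (z : ℂ) : Seq →L[ℂ] Seq :=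
  hopping (Real.cos (A * Real.pi)) - (2 * discr α z) • 1 - (γ / 2 * sinEnd z) • proj

theorem jacobi_apply (A α γ : ℝ) (z : ℂ) (x : Seq) (j : ℤ) :
    jacobi A α γ z x j = Real.cos (A * Real.pi) * (x (j + 1) + x (j - 1))
      - (2 * cosEnd z + impurityCoupling α γ j / 2 * sinEnd z) * x j := by
  have happly : jacobi A α γ z x j = Real.cos (A * Real.pi) * (x (j + 1) + x (j + -1))
      - 2 * discr α z * x j - (γ / 2 * sinEnd z) * proj x j := rfl
  rw [happly, proj_apply_apply, discr, impurityCoupling, ← sub_eq_add_neg]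
  split_ifs with hj
  · subst hj
    push_cast
    ring
  · ring

theorem jacobi_eq_sub (A α γ : ℝ) (z : ℂ) :
    jacobi A α γ z = jacobi A α 0 z - (γ / 2 * sinEnd z) • proj := by
  simp [jacobi]

/-- The candidate for the spectrum of the periodic chain: the Dirichlet energies of an edge, which
are flat bands, and the energies at which the Jacobi operator has bounded solutions. -/
def bandSet (A α : ℝ) : Set ℂ :=
  {z | sinEnd z = 0 ∨ ∃ t : ℝ, |t| ≤ |Real.cos (A * Real.pi)| ∧ discr α z = t}

theorem isUnit_sub_smul_one {𝕜 B : Type*} [CommRing 𝕜] [Ring B] [Algebra 𝕜 B] {b : B} {z : 𝕜} :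
    IsUnit (b - z • 1) ↔ z ∉ spectrum 𝕜 b := by
  rw [spectrum.notMem_iff, ← IsUnit.neg_iff, neg_sub, Algebra.algebraMap_eq_smul_one]

theorem isInvertible_jacobi {A α : ℝ} {z : ℂ} (hz : z ∉ bandSet A α) :
    (jacobi A α 0 z).IsInvertible := by
  have hjacobi : jacobi A α 0 z = hopping (Real.cos (A * Real.pi)) - (2 * discr α z) • 1 := by
    simp [jacobi]
  suffices hunit : IsUnit (jacobi A α 0 z) by
    obtain ⟨u, hu⟩ := hunit
    exact ⟨ContinuousLinearEquiv.unitsEquiv ℂ Seq u, by ext; simp [hu]⟩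
  rw [hjacobi, isUnit_sub_smul_one]
  intro hmem
  have hreal := (isSelfAdjoint_hopping _).mem_spectrum_eq_re hmem
  have hnorm := (spectrum.norm_le_norm_of_mem hmem).trans (norm_hopping_le _)
  refine hz (Or.inr ⟨(2 * discr α z).re / 2, ?_, ?_⟩)
  · rw [hreal, Complex.norm_real, Real.norm_eq_abs] at hnorm
    rw [abs_div, abs_two]
    linarith
  · push_cast
    rw [← hreal, mul_div_cancel_left₀ _ two_ne_zero]

/-! ### Vertex data of the elements of the domain -/

/-- The functions `u s j` represent `f` on the edges and, together with their quasiderivatives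
`p s j`, they show that `(f, g)` belongs to the graph of the Hamiltonian. -/
structure IsWitness (A : ℝ) (α : ℤ → ℝ) (f g : L2Graph) (u p : Fin 2 → ℤ → ℝ → ℂ) : Prop where
  ae_eq : ∀ s j, f s =ᵐ[volume.restrict (edge j)] u s j
  value : ∀ s j, HasQuasiDeriv (potential A s) j (u s j) (p s j)
  slope : ∀ s j, HasQuasiDeriv (potential A s) j (p s j) fun x => -g s x
  left_eq : ∀ s j, u s j (vertex j) = u 0 j (vertex j)
  right_eq : ∀ s j, u s j (vertex (j + 1)) = u 0 (j + 1) (vertex (j + 1))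
  flux : ∀ j, ∑ s, (p s j (vertex j) - p s (j - 1) (vertex j)) = α j * u 0 j (vertex j)

/-- The matching conditions at the vertices for the solutions of `-𝒟² f = z f + h` whose values and
quasiderivatives at the left ends of the edges are `P` and `q`. -/
structure VertexEquations (A : ℝ) (α : ℤ → ℝ) (z : ℂ) (h : L2Graph) (P : ℤ → ℂ)
    (q : Fin 2 → ℤ → ℂ) : Prop where
  continuity : ∀ s j, phase (potential A s) Real.pi * P (j + 1) =
    P j * cosEnd z + q s j * sinEnd z - moment A (ssol z) s j h
  flux : ∀ j, ∑ s, (q s j - phase (-potential A s) Real.pi *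
    (-(z * P (j - 1) * sinEnd z) + q s (j - 1) * cosEnd z - moment A (csol z) s (j - 1) h))
      = α j * P j

section EdgeSolution

variable {z : ℂ} {a : ℝ} {j : ℤ} {u p h : ℝ → ℂ}

theorem phase_mul_right_value (hu : HasQuasiDeriv a j u p)
    (hp : HasQuasiDeriv a j p fun x => -(z * u x + h x)) :
    phase a Real.pi * u (vertex (j + 1)) = u (vertex j) * cosEnd z + p (vertex j) * sinEnd z
      - ∫ t in vertex j..vertex (j + 1), gauge a j h t * ssol z (vertex (j + 1) - t) := by
  have h_end := (solvesOn_gauge_iff.2 ⟨hu, hp⟩).value_eq right_mem_uIcc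
  rwa [gauge_vertex, gauge_vertex, gauge, vertex_succ_sub] at h_end

theorem phase_mul_right_slope (hu : HasQuasiDeriv a j u p)
    (hp : HasQuasiDeriv a j p fun x => -(z * u x + h x)) :
    phase a Real.pi * p (vertex (j + 1))
      = -(z * u (vertex j) * sinEnd z) + p (vertex j) * cosEnd z
        - ∫ t in vertex j..vertex (j + 1), gauge a j h t * csol z (vertex (j + 1) - t) := by
  have h_end := (solvesOn_gauge_iff.2 ⟨hu, hp⟩).deriv_eq right_mem_uIcc
  rwa [gauge_vertex, gauge_vertex, gauge, vertex_succ_sub] at h_end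

theorem exists_hasQuasiDeriv (a : ℝ) (z P q : ℂ) (hh : IntegrableOn h (edge j)) :
    ∃ u p, HasQuasiDeriv a j u p ∧ (HasQuasiDeriv a j p fun x => -(z * u x + h x)) ∧
      u (vertex j) = P ∧ p (vertex j) = q := by
  obtain ⟨w, w', hw, hP, hq⟩ := exists_solvesOn z P q
    (intervalIntegrable_of_integrableOn_edge (integrableOn_gauge hh a))
  have hgauge : ∀ v, gauge a j (gauge (-a) j v) = v := by
    simpa using gauge_neg_gauge (-a) j
  rw [← hgauge w, ← hgauge w', solvesOn_gauge_iff] at hw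
  exact ⟨_, _, hw.1, hw.2, by simpa using hP, by simpa using hq⟩

end EdgeSolution

section Witness

variable {A : ℝ} {α : ℤ → ℝ} {z : ℂ} {f g f' g' h : L2Graph} {u p u' p' : Fin 2 → ℤ → ℝ → ℂ}

theorem isHamiltonianPair_iff : IsHamiltonianPair A α f g ↔ ∃ u p, IsWitness A α f g u p := by
  constructor
  · rintro ⟨u, p, hf, hu, hp, hmatch, hflux⟩
    refine ⟨u, p, hf, hu, hp, fun s j => (hmatch s j).1, fun s j => ?_, hflux⟩
    simpa using (hmatch s (j + 1)).2
  · rintro ⟨u, p, w⟩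
    refine ⟨u, p, w.ae_eq, w.value, w.slope, fun s j => ⟨w.left_eq s j, ?_⟩, w.flux⟩
    simpa using w.right_eq s (j - 1)

theorem smul_add_coeFn (c : ℂ) (f g : L2Graph) (s : Fin 2) :
    (c • f + g) s =ᵐ[volume] fun x => c * f s x + g s x := by
  filter_upwards [Lp.coeFn_add (c • f s) (g s), Lp.coeFn_smul c (f s)] with x hadd hsmul
  simp only [PiLp.add_apply, PiLp.smul_apply, hadd, Pi.add_apply, hsmul, Pi.smul_apply, smul_eq_mul]

theorem IsWitness.smul_add (c : ℂ) (w : IsWitness A α f g u p) (w' : IsWitness A α f' g' u' p') :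
    IsWitness A α (c • f + f') (c • g + g') (c • u + u') (c • p + p') where
  ae_eq s j := by
    filter_upwards [ae_restrict_of_ae (smul_add_coeFn c f f' s), w.ae_eq s j, w'.ae_eq s j]
      with x hadd hu hu'
    rw [hadd, hu, hu']
    rfl
  value s j := ((w.value s j).smul c).add (w'.value s j)
  slope s j := by
    refine (((w.slope s j).smul c).add (w'.slope s j)).congr ?_
    filter_upwards [smul_add_coeFn c g g' s] with x hadd
    simp only [hadd, Pi.add_apply, Pi.smul_apply, smul_eq_mul]
    ring
  left_eq s j := by simp [w.left_eq s j, w'.left_eq s j]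
  right_eq s j := by simp [w.right_eq s j, w'.right_eq s j]
  flux j := by
    have hflux := w.flux j
    have hflux' := w'.flux j
    simp only [Fin.sum_univ_two, Pi.add_apply, Pi.smul_apply, smul_eq_mul] at hflux hflux' ⊢
    linear_combination c * hflux + hflux'

theorem IsWitness.eq_zero (w : IsWitness A α 0 g u p) (s : Fin 2) (j : ℤ) :
    u s j (vertex j) = 0 ∧ p s j (vertex j) = 0 := by
  have hu : EqOn (u s j) 0 (edge j) := by
    refine Measure.eqOn_Icc_of_ae_eq volume (vertex_lt j).ne ?_ (w.value s j).1 continuousOn_const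
    exact (w.ae_eq s j).symm.trans (ae_restrict_of_ae (Lp.coeFn_zero ℂ 2 volume))
  have hp : EqOn (p s j) 0 (edge j) :=
    Measure.eqOn_Icc_of_ae_eq volume (vertex_lt j).ne ((w.value s j).ae_zero fun _ hx => hu hx)
      (w.slope s j).1 continuousOn_const
  exact ⟨hu (left_mem_edge j), hp (left_mem_edge j)⟩

theorem IsWitness.vertex_eq (w : IsWitness A α f g u p) (w' : IsWitness A α f g u' p')
    (s : Fin 2) (j : ℤ) :
    u s j (vertex j) = u' s j (vertex j) ∧ p s j (vertex j) = p' s j (vertex j) := by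
  have w_sub := w.smul_add (-1) w'
  rw [neg_one_smul, neg_add_cancel] at w_sub
  obtain ⟨hu, hp⟩ := w_sub.eq_zero s j
  simp only [neg_smul, one_smul, Pi.add_apply, Pi.neg_apply, neg_add_eq_zero] at hu hp
  exact ⟨hu, hp⟩

theorem IsWitness.slope_of_shifted (w : IsWitness A α f (z • f + h) u p) (s : Fin 2) (j : ℤ) :
    HasQuasiDeriv (potential A s) j (p s j) fun x => -(z * u s j x + h s x) := by
  refine (w.slope s j).congr_edge ?_
  filter_upwards [ae_restrict_of_ae (smul_add_coeFn z f h s), w.ae_eq s j] with x hadd hu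
  rw [hadd, hu]

theorem IsWitness.vertexEquations (w : IsWitness A α f (z • f + h) u p) :
    VertexEquations A α z h (fun j => u 0 j (vertex j)) (fun s j => p s j (vertex j)) where
  continuity s j := by
    rw [← w.right_eq s j, ← w.left_eq s j]
    exact phase_mul_right_value (w.value s j) (w.slope_of_shifted s j)
  flux j := by
    rw [← w.flux j]
    refine Finset.sum_congr rfl fun s _ => ?_
    have h_end := phase_mul_right_slope (w.value s (j - 1)) (w.slope_of_shifted s (j - 1))
    rw [sub_add_cancel, w.left_eq] at h_end
    rw [moment, sub_add_cancel, ← h_end, ← mul_assoc, phase_neg_mul_phase, one_mul]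

theorem exists_isWitness {P : ℤ → ℂ} {q : Fin 2 → ℤ → ℂ} (hPq : VertexEquations A α z h P q)
    (hP : Summable fun j => ‖P j‖ ^ 2) (hq : ∀ s, Summable fun j => ‖q s j‖ ^ 2) :
    ∃ f u p, IsWitness A α f (z • f + h) u p ∧ (∀ j, u 0 j (vertex j) = P j) ∧
      ∀ s j, p s j (vertex j) = q s j := by
  choose u p hu hp huP hpq using fun s j =>
    exists_hasQuasiDeriv (potential A s) z (P j) (q s j) (integrableOn_edge (h s) j)
  obtain ⟨K, -, hK⟩ := exists_sq_solution_le z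
  have hglue : ∀ s, MemLp (glue (u s)) 2 := fun s =>
    memLp_glue (fun j => (hu s j).1)
      (((hP.add (hq s)).add (summable_edgeSq h s)).mul_left K) fun j x hx => by
        simpa only [huP, hpq] using hK (hu s j) (hp s j) (memLp_edge (h s) j) x hx
  set f : L2Graph := WithLp.toLp 2 fun s => (hglue s).toLp
  have hf : ∀ s j, f s =ᵐ[volume.restrict (edge j)] u s j := by
    intro s j
    have hfs : f s =ᵐ[volume] glue (u s) := (hglue s).coeFn_toLp
    exact hfs.restrict.trans (glue_ae_eq (u s) j)
  refine ⟨f, u, p, ⟨hf, hu, fun s j => ?_, fun s j => ?_, fun s j => ?_, fun j => ?_⟩, huP 0, hpq⟩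
  · refine (hp s j).congr_edge ?_
    filter_upwards [ae_restrict_of_ae (smul_add_coeFn z f h s), hf s j] with x hadd hfu
    rw [hadd, hfu]
  · rw [huP, huP]
  · have h_end := phase_mul_right_value (hu s j) (hp s j)
    rw [huP, hpq, ← moment, ← hPq.continuity s j] at h_end
    rw [huP 0]
    exact mul_left_cancel₀ (phase_ne_zero _ _) h_end
  · rw [huP, ← hPq.flux j]
    refine Finset.sum_congr rfl fun s _ => ?_
    have h_end := phase_mul_right_slope (hu s (j - 1)) (hp s (j - 1))
    rw [← moment, huP, hpq, sub_add_cancel] at h_end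
    rw [hpq, ← h_end, ← mul_assoc, phase_neg_mul_phase, one_mul]

end Witness

section VertexData

variable {A : ℝ} {α : ℤ → ℝ}

theorem exists_isWitness_of_domain (x : (hamiltonian A α).domain) :
    ∃ up : (Fin 2 → ℤ → ℝ → ℂ) × (Fin 2 → ℤ → ℝ → ℂ),
      IsWitness A α x (hamiltonian A α x) up.1 up.2 := by
  obtain ⟨u, p, w⟩ := isHamiltonianPair_iff.1
    ((mem_graph_hamiltonian A α _ _).1 ((hamiltonian A α).mem_graph x))
  exact ⟨(u, p), w⟩

/-- The values at the vertices and the quasiderivatives at the left ends of the edges of an element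
of the domain. -/
def vertexData (A : ℝ) (α : ℤ → ℝ) :
    (hamiltonian A α).domain →ₗ[ℂ] (ℤ → ℂ) × (Fin 2 → ℤ → ℂ) :=
  have hw := fun x => (exists_isWitness_of_domain x).choose_spec
  { toFun x := (fun j => (exists_isWitness_of_domain x).choose.1 0 j (vertex j),
      fun s j => (exists_isWitness_of_domain x).choose.2 s j (vertex j))
    map_add' x y := by
      have w := (hw x).smul_add 1 (hw y)
      simp only [one_smul, ← LinearPMap.map_add, ← Submodule.coe_add] at w
      ext
      exacts [(hw (x + y)).vertex_eq w 0 _ |>.1, (hw (x + y)).vertex_eq w _ _ |>.2]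
    map_smul' c x := by
      have w := (hw x).smul_add (c - 1) (hw x)
      simp only [← LinearPMap.map_smul, ← Submodule.coe_smul, ← LinearPMap.map_add,
        ← Submodule.coe_add, sub_smul, one_smul, sub_add_cancel] at w
      ext
      exacts [(hw (c • x)).vertex_eq w 0 _ |>.1, (hw (c • x)).vertex_eq w _ _ |>.2] }

variable {z : ℂ} {h : L2Graph} {x : (hamiltonian A α).domain}

theorem IsWitness.vertexData_eq {u p : Fin 2 → ℤ → ℝ → ℂ}
    (w : IsWitness A α x (hamiltonian A α x) u p) :
    vertexData A α x = (fun j => u 0 j (vertex j), fun s j => p s j (vertex j)) := by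
  have w' := (exists_isWitness_of_domain x).choose_spec
  ext
  exacts [(w'.vertex_eq w 0 _).1, (w'.vertex_eq w _ _).2]

theorem hamiltonian_eq (x : (hamiltonian A α).domain) (z : ℂ) :
    hamiltonian A α x = z • (x : L2Graph) + shifted (hamiltonian A α) z x :=
  (add_sub_cancel _ _).symm

theorem exists_isWitness_vertexData (x : (hamiltonian A α).domain) (z : ℂ) :
    ∃ u p, IsWitness A α x (z • (x : L2Graph) + shifted (hamiltonian A α) z x) u p ∧
      vertexData A α x = (fun j => u 0 j (vertex j), fun s j => p s j (vertex j)) := by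
  obtain ⟨⟨u, p⟩, w⟩ := exists_isWitness_of_domain x
  exact ⟨u, p, hamiltonian_eq x z ▸ w, w.vertexData_eq⟩

theorem vertexEquations_vertexData (x : (hamiltonian A α).domain) (z : ℂ) :
    VertexEquations A α z (shifted (hamiltonian A α) z x)
      (vertexData A α x).1 (vertexData A α x).2 := by
  obtain ⟨u, p, w, hx⟩ := exists_isWitness_vertexData x z
  rw [hx]
  exact w.vertexEquations

theorem exists_vertexData_eq {P : ℤ → ℂ} {q : Fin 2 → ℤ → ℂ} (hPq : VertexEquations A α z h P q)
    (hP : Summable fun j => ‖P j‖ ^ 2) (hq : ∀ s, Summable fun j => ‖q s j‖ ^ 2) :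
    ∃ x : (hamiltonian A α).domain,
      shifted (hamiltonian A α) z x = h ∧ vertexData A α x = (P, q) := by
  obtain ⟨f, u, p, w, huP, hpq⟩ := exists_isWitness hPq hP hq
  have hmem := (mem_graph_hamiltonian A α _ _).2 (isHamiltonianPair_iff.2 ⟨u, p, w⟩)
  obtain ⟨x, rfl, hx⟩ := (LinearPMap.mem_graph_iff _).1 hmem
  refine ⟨x, add_left_cancel ((hamiltonian_eq x z).symm.trans hx), ?_⟩
  replace w : IsWitness A α x (hamiltonian A α x) u p := hx ▸ w
  simp only [w.vertexData_eq, huP, hpq]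

theorem exists_edgeSq_le_vertexData (A : ℝ) (α : ℤ → ℝ) (z : ℂ) :
    ∃ K, 0 ≤ K ∧ ∀ (x : (hamiltonian A α).domain) s j, edgeSq ((x : L2Graph) s) j ≤
      K * (‖(vertexData A α x).1 j‖ ^ 2 + ‖(vertexData A α x).2 s j‖ ^ 2
        + edgeSq (shifted (hamiltonian A α) z x s) j) := by
  obtain ⟨K, hK₀, hK⟩ := exists_sq_solution_le z
  refine ⟨Real.pi * K, by positivity, fun x s j => ?_⟩
  obtain ⟨u, p, w, hx⟩ := exists_isWitness_vertexData x z
  rw [hx, edgeSq_congr (w.ae_eq s j), mul_assoc]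
  simp only [← w.left_eq s j]
  exact edgeSq_le_of_bound (hK (w.value s j) (w.slope_of_shifted s j) (memLp_edge _ j))

theorem sq_norm_vertexData_le (x : (hamiltonian A α).domain) (j : ℤ) :
    ‖(vertexData A α x).1 j‖ ^ 2 ≤
      32 * Real.pi ^ 3 * (edgeSq ((x : L2Graph) 0) j + edgeSq (hamiltonian A α x 0) j) := by
  obtain ⟨⟨u, p⟩, w⟩ := exists_isWitness_of_domain x
  have hvertex := sq_norm_vertex_le (w.value 0 j) (w.slope 0 j) (memLp_edge _ j).neg
  rw [w.vertexData_eq, edgeSq_congr (w.ae_eq 0 j)]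
  simpa only [edgeSq, norm_neg] using hvertex

theorem summable_sq_norm_vertexData (x : (hamiltonian A α).domain) :
    Summable fun j => ‖(vertexData A α x).1 j‖ ^ 2 :=
  .of_nonneg_of_le (fun _ => by positivity) (sq_norm_vertexData_le x)
    (((summable_edgeSq _ 0).add (summable_edgeSq _ 0)).mul_left _)

end VertexData

/-! ### Reduction of an operator to boundary values -/

section Fredholm

open LinearMap.FiniteRangeSetoid

theorem isFredholm_sub_of_finite_range {E : Type*} [NormedAddCommGroup E] [NormedSpace ℂ E]
    {J K : E →L[ℂ] E} (hJ : J.IsInvertible) (hK : (K : E →ₗ[ℂ] E).HasFiniteRange) :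
    (J - K).IsFredholm := by
  obtain ⟨e, rfl⟩ := hJ
  refine .of_isQuasiInverse (v := (e.symm : E →L[ℂ] E))
    (e.toLinearEquiv.isQuasiInverse.congr (Setoid.refl _) ?_)
  rw [equiv_iff_hasFiniteRange]
  have hsub : ((e - K : E →L[ℂ] E) : E →ₗ[ℂ] E) - e.toLinearEquiv = -(K : E →ₗ[ℂ] E) := by
    ext
    simp
  rw [hsub]
  exact hK.neg

end Fredholm

/-- The operator `T` is reduced to `J` by the trace map `τ` and the source map `S`: the traces of
the solutions of `T x = h` are the solutions of `J P = S h`, and every solution is determined by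
its trace, with bounds. -/
structure IsReduction {D H E : Type*} [NormedAddCommGroup D] [NormedSpace ℂ D]
    [NormedAddCommGroup H] [NormedSpace ℂ H] [NormedAddCommGroup E] [NormedSpace ℂ E]
    (T : D →ₗ[ℂ] H) (τ : D →ₗ[ℂ] E) (J : E →L[ℂ] E) (S : H →L[ℂ] E) : Prop where
  trace_eq : ∀ x, J (τ x) = S (T x)
  exists_solution : ∀ P h, J P = S h → ∃ x, T x = h ∧ τ x = P
  bound : ∃ C, ∀ x, ‖x‖ ≤ C * ‖(τ x, T x)‖

namespace IsReduction

variable {D H E : Type*} [NormedAddCommGroup D] [NormedSpace ℂ D] [NormedAddCommGroup H]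
  [NormedSpace ℂ H] [NormedAddCommGroup E] [NormedSpace ℂ E]
  {T : D →ₗ[ℂ] H} {τ : D →ₗ[ℂ] E} {J : E →L[ℂ] E} {S : H →L[ℂ] E}

theorem eq_zero (hT : IsReduction T τ J S) {x : D} (hx : T x = 0) (hτ : τ x = 0) : x = 0 := by
  obtain ⟨C, hC⟩ := hT.bound
  simpa [hx, hτ] using hC x

theorem range_eq (hT : IsReduction T τ J S) :
    LinearMap.range T = (LinearMap.range (J : E →ₗ[ℂ] E)).comap (S : H →ₗ[ℂ] E) := by
  ext h
  constructor
  · rintro ⟨x, rfl⟩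
    exact ⟨τ x, hT.trace_eq x⟩
  · rintro ⟨P, hP⟩
    obtain ⟨x, hx, -⟩ := hT.exists_solution P h hP
    exact ⟨x, hx⟩

/-- The trace map identifies the kernels of `T` and `J`. -/
def kerEquiv (hT : IsReduction T τ J S) : LinearMap.ker T ≃ₗ[ℂ] LinearMap.ker (J : E →ₗ[ℂ] E) :=
  .ofBijective (τ.restrict fun x (hx : T x = 0) => by simp [hT.trace_eq, hx]) <| by
    constructor
    · refine (injective_iff_map_eq_zero _).2 fun x hx => ?_
      exact Subtype.ext (hT.eq_zero x.2 (congrArg Subtype.val hx))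
    · rintro ⟨P, hP : J P = 0⟩
      obtain ⟨x, hx, hτ⟩ := hT.exists_solution P 0 (by simpa using hP)
      exact ⟨⟨x, hx⟩, Subtype.ext hτ⟩

theorem bijective_and_bound (hT : IsReduction T τ J S) (hJ : J.IsInvertible) :
    Function.Bijective T ∧ ∃ C, ∀ x, ‖x‖ ≤ C * ‖T x‖ := by
  obtain ⟨e, rfl⟩ := hJ
  have hτ : ∀ x, τ x = (e.symm : E →L[ℂ] E).comp S (T x) := fun x =>
    e.injective (by simpa using hT.trace_eq x)
  refine ⟨⟨(injective_iff_map_eq_zero T).2 fun x hx => hT.eq_zero hx ?_, fun h => ?_⟩, ?_⟩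
  · rw [hτ, hx, map_zero]
  · obtain ⟨x, hx, -⟩ := hT.exists_solution (e.symm (S h)) h (by simp)
    exact ⟨x, hx⟩
  · obtain ⟨C, hC⟩ := hT.bound
    set R := ((e.symm : E →L[ℂ] E).comp S).prod (.id ℂ H)
    refine ⟨|C| * ‖R‖, fun x => (hC x).trans ?_⟩
    have hR : (τ x, T x) = R (T x) := Prod.ext (hτ x) rfl
    rw [hR, mul_assoc]
    gcongr
    exacts [le_abs_self C, R.le_opNorm _]

theorem fredholm (hT : IsReduction T τ J S) (hJ : J.IsFredholm) :
    FiniteDimensional ℂ (LinearMap.ker T) ∧ IsClosed (LinearMap.range T : Set H) ∧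
      FiniteDimensional ℂ (H ⧸ LinearMap.range T) := by
  have := hJ.finite_ker
  refine ⟨hT.kerEquiv.symm.finiteDimensional, ?_, ?_⟩
  · rw [hT.range_eq]
    exact hJ.isClosed_range.preimage S.continuous
  · have : FiniteDimensional ℂ (E ⧸ LinearMap.range (J : E →ₗ[ℂ] E)) := hJ.finite_coker
    rw [hT.range_eq, ← Submodule.ker_mkQ (LinearMap.range (J : E →ₗ[ℂ] E)), ← LinearMap.ker_comp]
    exact Submodule.CoFG.ker _

theorem finite_ker_and_isClosed_range [CompleteSpace H] [CompleteSpace E]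
    (hT : IsReduction T τ J S) (hS : Function.Surjective S)
    (hker : FiniteDimensional ℂ (LinearMap.ker T)) (hrange : IsClosed (LinearMap.range T : Set H)) :
    FiniteDimensional ℂ (LinearMap.ker (J : E →ₗ[ℂ] E)) ∧
      IsClosed (LinearMap.range (J : E →ₗ[ℂ] E) : Set E) := by
  refine ⟨hT.kerEquiv.finiteDimensional, ?_⟩
  rw [hT.range_eq] at hrange
  exact (S.isQuotientMap hS).isClosed_preimage.1 hrange

end IsReduction

/-! ### The equation for the vertex values -/

/-- The sequence of the moments of a source on one side of the chain. -/
def momentSeq (A : ℝ) {χ : ℝ → ℂ} (hχ : Continuous χ) (s : Fin 2) : L2Graph →L[ℂ] Seq :=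
  have hsummable : ∀ h : L2Graph, Summable fun j => ‖moment A χ s j h‖ ^ 2 := fun h =>
    let ⟨_, _, hK⟩ := exists_sq_moment_le hχ
    .of_nonneg_of_le (fun _ => by positivity) (hK A s · h) ((summable_edgeSq h s).mul_left _)
  LinearMap.mkContinuousOfExistsBound
    { toFun h := Seq.mk (fun j => moment A χ s j h) (hsummable h)
      map_add' h h' := by ext j; exact moment_add A hχ s j h h'
      map_smul' c h := by ext j; exact moment_smul A χ s j c h } <| by
    obtain ⟨K, hK₀, hK⟩ := exists_sq_moment_le hχ
    refine ⟨√K, fun h => ?_⟩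
    rw [← Real.sqrt_sq (norm_nonneg h), ← Real.sqrt_mul hK₀]
    refine Real.le_sqrt_of_sq_le (hasSum_le (fun j => ?_) (Seq.hasSum_norm_sq _)
      ((hasSum_edgeSq h).mul_left K))
    refine (hK A s j h).trans ?_
    gcongr
    exact Finset.single_le_sum (f := fun s => edgeSq (h s) j) (fun _ _ => edgeSq_nonneg _ j)
      (Finset.mem_univ s)

/-- The right-hand side of the equation for the vertex values produced by a source. -/
def source (A : ℝ) (z : ℂ) : L2Graph →L[ℂ] Seq :=
  -(1 / 2 : ℂ) • ∑ s, (momentSeq A (continuous_ssol z) s + phase (-potential A s) Real.pi •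
    (shift (-1)).toContinuousLinearMap.comp
      (sinEnd z • momentSeq A (continuous_csol z) s - cosEnd z • momentSeq A (continuous_ssol z) s))

theorem source_apply (A : ℝ) (z : ℂ) (h : L2Graph) (j : ℤ) :
    source A z h j = -(1 / 2) * ∑ s, (moment A (ssol z) s j h + phase (-potential A s) Real.pi *
      (sinEnd z * moment A (csol z) s (j - 1) h - cosEnd z * moment A (ssol z) s (j - 1) h)) := by
  simp only [source, Fin.sum_univ_two]
  rfl

/-- The quasiderivatives at the left ends of the edges in terms of the vertex values and the source.
It inverts the continuity conditions, so `sinEnd z` must not vanish. -/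
def slope (A : ℝ) (z : ℂ) (s : Fin 2) : Seq × L2Graph →L[ℂ] Seq :=
  (sinEnd z)⁻¹ • (phase (potential A s) Real.pi • (shift 1).toContinuousLinearMap
    - cosEnd z • .id ℂ Seq).coprod (momentSeq A (continuous_ssol z) s)

section VertexEquation

variable {A α γ : ℝ} {z : ℂ} {h : L2Graph} {P : Seq}

theorem sinEnd_mul_slope (hz : sinEnd z ≠ 0) (A : ℝ) (s : Fin 2) (P : Seq) (h : L2Graph) (j : ℤ) :
    sinEnd z * slope A z s (P, h) j = phase (potential A s) Real.pi * P (j + 1) - cosEnd z * P j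
      + moment A (ssol z) s j h :=
  mul_inv_cancel_left₀ hz _

theorem sum_phase (A : ℝ) :
    ∑ s, phase (potential A s) Real.pi = 2 * (Real.cos (A * Real.pi) : ℂ) := by
  rw [Fin.sum_univ_two, Complex.ofReal_cos, Complex.two_cos]
  simp only [potential, phase, Matrix.cons_val_zero, Matrix.cons_val_one]
  push_cast
  ring_nf

theorem sum_phase_neg (A : ℝ) :
    ∑ s, phase (-potential A s) Real.pi = 2 * (Real.cos (A * Real.pi) : ℂ) := by
  rw [Fin.sum_univ_two, Complex.ofReal_cos, Complex.two_cos]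
  simp only [potential, phase, Matrix.cons_val_zero, Matrix.cons_val_one]
  push_cast
  ring_nf

theorem sinEnd_mul_sum_slope (hz : sinEnd z ≠ 0) (A : ℝ) (P : Seq) (h : L2Graph) (j : ℤ) :
    sinEnd z * ∑ s, (slope A z s (P, h) j - phase (-potential A s) Real.pi *
      (-(z * P (j - 1) * sinEnd z) + slope A z s (P, h) (j - 1) * cosEnd z
        - moment A (csol z) s (j - 1) h)) =
      2 * (Real.cos (A * Real.pi) * (P (j + 1) + P (j - 1)) - 2 * cosEnd z * P j
        - source A z h j) := by
  rw [source_apply]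
  have hphase : ∑ s, (phase (potential A s) Real.pi * P (j + 1)
      + phase (-potential A s) Real.pi * P (j - 1))
        = 2 * Real.cos (A * Real.pi) * (P (j + 1) + P (j - 1)) := by
    rw [Finset.sum_add_distrib, ← Finset.sum_mul, ← Finset.sum_mul, sum_phase, sum_phase_neg,
      mul_add]
  have hside : ∀ s, sinEnd z * (slope A z s (P, h) j - phase (-potential A s) Real.pi *
      (-(z * P (j - 1) * sinEnd z) + slope A z s (P, h) (j - 1) * cosEnd z
        - moment A (csol z) s (j - 1) h)) =
      phase (potential A s) Real.pi * P (j + 1) + phase (-potential A s) Real.pi * P (j - 1)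
        - 2 * cosEnd z * P j + (moment A (ssol z) s j h + phase (-potential A s) Real.pi *
          (sinEnd z * moment A (csol z) s (j - 1) h
            - cosEnd z * moment A (ssol z) s (j - 1) h)) := by
    intro s
    have hleft := sinEnd_mul_slope hz A s P h (j - 1)
    rw [sub_add_cancel] at hleft
    have hwronskian : cosEnd z ^ 2 + z * sinEnd z ^ 2 = 1 := csol_sq_add z Real.pi
    linear_combination sinEnd_mul_slope hz A s P h j
      - phase (-potential A s) Real.pi * cosEnd z * hleft
      - cosEnd z * P j * phase_neg_mul_phase (potential A s) Real.pi
      + phase (-potential A s) Real.pi * P (j - 1) * hwronskian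
  simp only [Fin.sum_univ_two] at hphase ⊢
  linear_combination hside 0 + hside 1 + hphase

theorem vertexEquations_iff (hz : sinEnd z ≠ 0) {q : Fin 2 → ℤ → ℂ} :
    VertexEquations A (impurityCoupling α γ) z h P q ↔
      q = (fun s j => slope A z s (P, h) j) ∧ jacobi A α γ z P = source A z h := by
  have hflux : ∀ j, ∑ s, (slope A z s (P, h) j - phase (-potential A s) Real.pi *
      (-(z * P (j - 1) * sinEnd z) + slope A z s (P, h) (j - 1) * cosEnd z
        - moment A (csol z) s (j - 1) h)) = impurityCoupling α γ j * P j ↔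
      jacobi A α γ z P j = source A z h j := by
    intro j
    rw [← mul_right_inj' hz, sinEnd_mul_sum_slope hz, jacobi_apply]
    exact ⟨fun hj => by linear_combination hj / 2, fun hj => by linear_combination 2 * hj⟩
  have hcontinuity : (∀ s j, phase (potential A s) Real.pi * P (j + 1) =
      P j * cosEnd z + q s j * sinEnd z - moment A (ssol z) s j h) ↔
        q = fun s j => slope A z s (P, h) j := by
    simp only [funext_iff]
    refine forall₂_congr fun s j => ?_
    rw [← mul_right_inj' (b := q s j) hz, sinEnd_mul_slope hz]
    exact ⟨fun hj => by linear_combination -hj, fun hj => by linear_combination -hj⟩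
  constructor
  · intro hV
    obtain rfl := hcontinuity.1 hV.continuity
    exact ⟨rfl, lp.ext (funext fun j => (hflux j).1 (hV.flux j))⟩
  · rintro ⟨rfl, hP⟩
    exact ⟨hcontinuity.2 rfl, fun j => (hflux j).2 (by rw [hP])⟩

end VertexEquation

/-- The vertex values of the elements of the domain. -/
def trace (A : ℝ) (α : ℤ → ℝ) : (hamiltonian A α).domain →ₗ[ℂ] Seq where
  toFun x := Seq.mk (vertexData A α x).1 (summable_sq_norm_vertexData x)
  map_add' x y := by
    ext
    simp [Seq.add_apply]
  map_smul' c x := by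
    ext
    simp [Seq.smul_apply]

section Reduction

variable {z : ℂ}

theorem vertexData_eq_slope (hz : sinEnd z ≠ 0) {A α γ : ℝ}
    (x : (hamiltonian A (impurityCoupling α γ)).domain) :
    (vertexData A _ x).2 = (fun s j => slope A z s (trace A _ x, shifted _ z x) j) ∧
      jacobi A α γ z (trace A _ x) = source A z (shifted _ z x) :=
  (vertexEquations_iff hz).1 (vertexEquations_vertexData x z)

theorem exists_sq_norm_le_trace (hz : sinEnd z ≠ 0) (A α γ : ℝ) :
    ∃ K, ∀ x : (hamiltonian A (impurityCoupling α γ)).domain,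
      ‖x‖ ^ 2 ≤ K * ‖(trace A _ x, shifted _ z x)‖ ^ 2 := by
  obtain ⟨K, hK₀, hK⟩ := exists_edgeSq_le_vertexData A (impurityCoupling α γ) z
  refine ⟨K * (3 + ∑ s, ‖slope A z s‖ ^ 2), fun x => ?_⟩
  set y := (trace A _ x, shifted _ z x)
  have hsum : HasSum (fun j => ∑ s, K * (‖y.1 j‖ ^ 2 + ‖slope A z s y j‖ ^ 2 + edgeSq (y.2 s) j))
      (K * (2 * ‖y.1‖ ^ 2 + ∑ s, ‖slope A z s y‖ ^ 2 + ‖y.2‖ ^ 2)) := by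
    have hslope := fun s => (slope A z s y).hasSum_norm_sq
    simp only [Fin.sum_univ_two]
    have hside := (((y.1.hasSum_norm_sq.mul_left 2).add ((hslope 0).add (hslope 1))).add
      (hasSum_edgeSq y.2)).mul_left K
    refine hside.congr_fun fun j => ?_
    simp only [Fin.sum_univ_two]
    ring
  refine (hasSum_le (fun j => Finset.sum_le_sum fun s _ => ?_) (hasSum_edgeSq (x : L2Graph))
    hsum).trans ?_
  · refine (hK x s j).trans_eq ?_
    rw [(vertexData_eq_slope hz x).1]
    rfl
  · calc K * (2 * ‖y.1‖ ^ 2 + ∑ s, ‖slope A z s y‖ ^ 2 + ‖y.2‖ ^ 2)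
        ≤ K * (2 * ‖y‖ ^ 2 + ∑ s, (‖slope A z s‖ * ‖y‖) ^ 2 + ‖y‖ ^ 2) := by
          gcongr
          exacts [norm_fst_le y, (slope A z _).le_opNorm y, norm_snd_le y]
      _ = K * (3 + ∑ s, ‖slope A z s‖ ^ 2) * ‖y‖ ^ 2 := by
          simp only [mul_pow, ← Finset.sum_mul]
          ring

theorem isReduction_trace (hz : sinEnd z ≠ 0) (A α γ : ℝ) :
    IsReduction (shifted (hamiltonian A (impurityCoupling α γ)) z) (trace A _) (jacobi A α γ z)
      (source A z) where
  trace_eq x := (vertexData_eq_slope hz x).2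
  exists_solution P h hPh := by
    obtain ⟨x, hx, hdata⟩ := exists_vertexData_eq ((vertexEquations_iff hz).2 ⟨rfl, hPh⟩)
      P.hasSum_norm_sq.summable fun s => (slope A z s (P, h)).hasSum_norm_sq.summable
    exact ⟨x, hx, lp.ext (congrArg Prod.fst hdata)⟩
  bound := by
    obtain ⟨K, hK⟩ := exists_sq_norm_le_trace hz A α γ
    refine ⟨√K, fun x => ?_⟩
    rw [← Real.sqrt_sq (norm_nonneg (_, _)), ← Real.sqrt_mul' _ (sq_nonneg _)]
    exact Real.le_sqrt_of_sq_le (hK x)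

theorem notMem_spectrumSet (A α : ℝ) (hz : z ∉ bandSet A α) :
    z ∉ spectrumSet (hamiltonian A (impurityCoupling α 0)) :=
  not_not.2 ((isReduction_trace (fun h => hz (.inl h)) A α 0).bijective_and_bound
    (isInvertible_jacobi hz))

theorem isFredholm_jacobi {A α : ℝ} (γ : ℝ) (hz : z ∉ bandSet A α) :
    (jacobi A α γ z).IsFredholm := by
  rw [jacobi_eq_sub]
  refine isFredholm_sub_of_finite_range (isInvertible_jacobi hz) ?_
  have hproj : (proj : Seq →ₗ[ℂ] Seq).HasFiniteRange :=
    (LinearMap.HasFiniteRange.of_finite_dom (f := lp.lsingle 2 1)).comp_right _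
  exact hproj.smul _

theorem notMem_essentialSpectrum {A α : ℝ} (γ : ℝ) (hz : z ∉ bandSet A α) :
    z ∉ essentialSpectrum (hamiltonian A (impurityCoupling α γ)) :=
  not_not.2 ((isReduction_trace (fun h => hz (.inl h)) A α γ).fredholm (isFredholm_jacobi γ hz))

end Reduction

/-! ### The essential spectrum -/

section SourceSurjective

theorem exists_profile (z b : ℂ) :
    ∃ η : ℝ → ℂ, Continuous η ∧ (∫ t in (0 : ℝ)..Real.pi, η t * ssol z (Real.pi - t)) = 1 ∧
      (∫ t in (0 : ℝ)..Real.pi, η t * csol z (Real.pi - t)) = b := by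
  set w : ℝ → ℂ := fun x =>
    (Complex.cos x - 1) / 2 + b / 2 * (Complex.sin x * (1 - Complex.cos x))
  set w' : ℝ → ℂ := fun x =>
    -Complex.sin x / 2 + b / 2 * (Complex.cos x * (1 - Complex.cos x) + Complex.sin x ^ 2)
  set η : ℝ → ℂ := fun x =>
    Complex.cos x / 2 + b / 2 * (Complex.sin x * (1 - 4 * Complex.cos x)) - z * w x
  have hsin : ∀ x : ℝ, HasDerivAt (fun x : ℝ => Complex.sin x) (Complex.cos x) x :=
    fun x => (Complex.hasDerivAt_sin x).comp_ofReal
  have hcos : ∀ x : ℝ, HasDerivAt (fun x : ℝ => Complex.cos x) (-Complex.sin x) x :=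
    fun x => (Complex.hasDerivAt_cos x).comp_ofReal
  have hw : ∀ x, HasDerivAt w (w' x) x := fun x =>
    ((((hcos x).sub_const 1).div_const 2).add
      (((hsin x).mul ((hcos x).const_sub 1)).const_mul (b / 2))).congr_deriv (by ring)
  have hw' : ∀ x, HasDerivAt w' (-(z * w x + η x)) x := fun x =>
    (((hsin x).neg.div_const 2).add ((((hcos x).mul ((hcos x).const_sub 1)).add
      ((hsin x).pow 2)).const_mul (b / 2))).congr_deriv (by simp only [η]; ring)
  have hη : Continuous η := by fun_prop
  have hsolves : SolvesOn z η w w' 0 Real.pi :=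
    ⟨.of_hasDerivAt hw (by fun_prop), .of_hasDerivAt hw' (by fun_prop)⟩
  have hvalue := hsolves.value_eq right_mem_uIcc
  have hderiv := hsolves.deriv_eq right_mem_uIcc
  norm_num [w, w'] at hvalue hderiv
  exact ⟨η, hη, hvalue.symm, hderiv.symm⟩

theorem moment_eq_integral {A : ℝ} {s : Fin 2} {j : ℤ} {h : L2Graph} {v : ℝ → ℂ}
    (hv : h s =ᵐ[volume.restrict (edge j)] gauge (-potential A s) j fun t => v (t - vertex j))
    (χ : ℝ → ℂ) : moment A χ s j h = ∫ t in (0 : ℝ)..Real.pi, v t * χ (Real.pi - t) := by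
  have htranslate := intervalIntegral.integral_comp_sub_right (a := vertex j)
    (b := vertex (j + 1)) (fun t => v t * χ (Real.pi - t)) (vertex j)
  rw [sub_self, vertex_succ_sub] at htranslate
  rw [← htranslate]
  refine intervalIntegral.integral_congr_ae ?_
  filter_upwards [(ae_restrict_iff' (measurableSet_edge j)).1 hv] with t ht htm
  rw [uIoc_of_le (vertex_lt j).le] at htm
  rw [gauge, ht (Ioc_subset_Icc_self htm), gauge, ← mul_assoc, mul_comm (phase _ _),
    phase_neg_mul_phase, one_mul, ← vertex_succ_sub j, sub_sub_sub_cancel_right]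

theorem exists_moment_eq (A : ℝ) {η : ℝ → ℂ} (hη : Continuous η) (d : Seq) :
    ∃ h : L2Graph, ∀ χ j, moment A χ 0 j h =
      d j * (∫ t in (0 : ℝ)..Real.pi, η t * χ (Real.pi - t)) ∧ moment A χ 1 j h = 0 := by
  obtain ⟨K, hK⟩ := isCompact_Icc.exists_bound_of_continuousOn (s := Icc 0 Real.pi) hη.continuousOn
  set u : ℤ → ℝ → ℂ := fun j => gauge (-potential A 0) j fun t => d j * η (t - vertex j)
  have hu : MemLp (glue u) 2 := by
    refine memLp_glue (fun j => ?_) (d.hasSum_norm_sq.summable.mul_right (K ^ 2)) fun j x hx => ?_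
    · unfold u gauge
      fun_prop
    · have hx' : x - vertex j ∈ Icc 0 Real.pi :=
        ⟨sub_nonneg.2 hx.1, (sub_le_sub_right hx.2 _).trans_eq (vertex_succ_sub j)⟩
      rw [norm_gauge, norm_mul, mul_pow]
      gcongr
      exact hK _ hx'
  refine ⟨WithLp.toLp 2 ![hu.toLp, 0], fun χ j => ⟨?_, ?_⟩⟩
  · have hupper : hu.toLp =ᵐ[volume.restrict (edge j)] u j :=
      Filter.EventuallyEq.trans (ae_restrict_of_ae hu.coeFn_toLp) (glue_ae_eq u j)
    rw [moment_eq_integral (v := fun t => d j * η t) hupper, ← intervalIntegral.integral_const_mul]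
    simp only [mul_assoc]
  · have hlower : (0 : Lp ℂ 2 (volume : Measure ℝ)) =ᵐ[volume.restrict (edge j)]
        gauge (-potential A 1) j 0 := by
      filter_upwards [ae_restrict_of_ae (Lp.coeFn_zero ℂ 2 volume)] with t ht
      exact ht.trans (by simp [gauge])
    rw [moment_eq_integral (v := 0) hlower]
    simp

theorem source_surjective {z : ℂ} (hz : sinEnd z ≠ 0) (A : ℝ) :
    Function.Surjective (source A z) := by
  intro d
  obtain ⟨η, hη, hsin, hcos⟩ := exists_profile z (cosEnd z / sinEnd z)
  obtain ⟨h, hh⟩ := exists_moment_eq A hη ((-2 : ℂ) • d)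
  refine ⟨h, lp.ext (funext fun j => ?_)⟩
  rw [source_apply, Fin.sum_univ_two]
  simp only [hh, hsin, hcos, Seq.smul_apply]
  field_simp
  ring

end SourceSurjective

section SingularSequence

open Filter Topology

variable {E : Type*} [NormedAddCommGroup E] [InnerProductSpace ℂ E]

theorem not_tendsto_of_orthonormal {x : ℕ → E} (hx : Orthonormal ℂ x) (a : E) :
    ¬Tendsto x atTop (𝓝 a) := by
  intro ha
  have hinner := ha.inner (𝕜 := ℂ) (ha.comp (tendsto_add_atTop_nat 1))
  have hzero : ∀ n, inner ℂ (x n) (x (n + 1)) = 0 := fun n => hx.2 n.lt_succ_self.ne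
  have hnorm := ha.norm
  simp only [Function.comp_def, hzero, hx.1] at hinner hnorm
  have ha₀ := inner_self_eq_zero.1 (tendsto_nhds_unique hinner tendsto_const_nhds)
  simpa [ha₀] using tendsto_nhds_unique hnorm tendsto_const_nhds

theorem inner_sum_of_orthonormal {ι : Type*} [DecidableEq ι] {v : ι → E} (hv : Orthonormal ℂ v)
    (s t : Finset ι) : inner ℂ (∑ i ∈ s, v i) (∑ i ∈ t, v i) = ((s ∩ t).card : ℂ) := by
  simp [orthonormal_iff_ite.1 hv, ← Finset.filter_mem_eq_inter,
    Finset.inter_comm s t]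

theorem orthonormal_dyadic_blocks {v : ℕ → E} (hv : Orthonormal ℂ v) :
    Orthonormal ℂ fun n =>
      (((√2)⁻¹ ^ n : ℝ) : ℂ) • ∑ k ∈ Finset.Ico (2 ^ n) (2 ^ (n + 1)), v k := by
  rw [orthonormal_iff_ite]
  intro m n
  rw [inner_smul_left, inner_smul_right, inner_sum_of_orthonormal hv, Complex.conj_ofReal]
  split_ifs with hmn
  · subst hmn
    have hcard : 2 ^ (m + 1) - 2 ^ m = 2 ^ m := by rw [pow_succ, mul_two, Nat.add_sub_cancel]
    have hnormalized : (√2)⁻¹ ^ m * ((√2)⁻¹ ^ m * (2 : ℝ) ^ m) = 1 := by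
      rw [← mul_pow, ← mul_pow, ← mul_assoc, ← mul_inv, Real.mul_self_sqrt zero_le_two,
        inv_mul_cancel₀ two_ne_zero, one_pow]
    rw [Finset.inter_self, Nat.card_Ico, hcard]
    exact_mod_cast hnormalized
  · have hmono : Monotone fun n => 2 ^ n := pow_right_mono₀ (one_le_two (α := ℕ))
    have hdisjoint : Disjoint (Ico (2 ^ m) (2 ^ (m + 1))) (Ico (2 ^ n) (2 ^ (n + 1))) :=
      hmono.pairwise_disjoint_on_Ico_succ hmn
    rw [← Finset.coe_Ico, ← Finset.coe_Ico, Finset.disjoint_coe] at hdisjoint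
    simp [Finset.disjoint_iff_inter_eq_empty.1 hdisjoint]

variable [CompleteSpace E] {J : E →L[ℂ] E}

theorem exists_norm_sub_starProjection_ker_le
    (hrange : IsClosed (LinearMap.range (J : E →ₗ[ℂ] E) : Set E))
    [(LinearMap.ker (J : E →ₗ[ℂ] E)).HasOrthogonalProjection] :
    ∃ K : ℝ, ∀ x, ‖x - (LinearMap.ker (J : E →ₗ[ℂ] E)).starProjection x‖ ≤ K * ‖J x‖ := by
  set N := LinearMap.ker (J : E →ₗ[ℂ] E)
  have hJ : ∀ x, J (x - N.starProjection x) = J x := fun x => by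
    rw [map_sub, sub_eq_self]
    exact N.starProjection_apply_mem x
  set R := J.comp Nᗮ.subtypeL
  have hinj : Function.Injective R := by
    refine (injective_iff_map_eq_zero R).2 fun y hy => Subtype.ext ?_
    exact N.inf_orthogonal_eq_bot.le ⟨hy, y.2⟩
  have hrange' : Set.range R = LinearMap.range (J : E →ₗ[ℂ] E) := by
    refine Subset.antisymm (range_subset_iff.2 fun y => ⟨y, rfl⟩) ?_
    rintro _ ⟨x, rfl⟩
    exact ⟨⟨_, N.sub_starProjection_mem_orthogonal x⟩, hJ x⟩
  obtain ⟨K, hK⟩ := R.antilipschitz_of_injective_of_isClosed_range hinj (hrange' ▸ hrange)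
  refine ⟨K, fun x => ?_⟩
  rw [← hJ x]
  exact ZeroHomClass.bound_of_antilipschitz R hK ⟨_, N.sub_starProjection_mem_orthogonal x⟩

theorem not_isClosed_range_of_orthonormal [FiniteDimensional ℂ (LinearMap.ker (J : E →ₗ[ℂ] E))]
    {x : ℕ → E} (hx : Orthonormal ℂ x) (hJx : Tendsto (fun n => J (x n)) atTop (𝓝 0)) :
    ¬IsClosed (LinearMap.range (J : E →ₗ[ℂ] E) : Set E) := by
  intro hrange
  obtain ⟨K, hK⟩ := exists_norm_sub_starProjection_ker_le hrange
  set N := LinearMap.ker (J : E →ₗ[ℂ] E)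
  have := FiniteDimensional.proper_rclike ℂ N
  have hbound : ∀ n, N.orthogonalProjectionOnto (x n) ∈ Metric.closedBall 0 1 := fun n => by
    simpa [hx.1] using N.norm_orthogonalProjectionOnto_apply_le (x n)
  obtain ⟨a, -, φ, hφ, ha⟩ := (isCompact_closedBall _ _).tendsto_subseq hbound
  have hdist : Tendsto (fun n => x n - N.starProjection (x n)) atTop (𝓝 0) :=
    squeeze_zero_norm (fun n => hK (x n)) (by simpa using hJx.norm.const_mul K)
  refine not_tendsto_of_orthonormal (hx.comp φ hφ.injective) a ?_
  have hlim := ((continuous_subtype_val.tendsto a).comp ha).add (hdist.comp hφ.tendsto_atTop)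
  simpa [Function.comp_def] using hlim

theorem not_isClosed_range_of_telescoping [FiniteDimensional ℂ (LinearMap.ker (J : E →ₗ[ℂ] E))]
    {v g : ℕ → E} (hv : Orthonormal ℂ v) {B : ℝ} (hg : ∀ k, ‖g k‖ ≤ B)
    (hJv : ∀ k, J (v k) = g (k + 1) - g k) :
    ¬IsClosed (LinearMap.range (J : E →ₗ[ℂ] E) : Set E) := by
  refine not_isClosed_range_of_orthonormal (orthonormal_dyadic_blocks hv) ?_
  have hbound : ∀ n, ‖J ((((√2)⁻¹ ^ n : ℝ) : ℂ) • ∑ k ∈ Finset.Ico (2 ^ n) (2 ^ (n + 1)), v k)‖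
      ≤ (√2)⁻¹ ^ n * (B + B) := by
    intro n
    rw [map_smul, map_sum, norm_smul, Complex.norm_real, Real.norm_of_nonneg (by positivity)]
    simp only [hJv]
    rw [Finset.sum_Ico_sub _ (Nat.pow_le_pow_right two_pos n.le_succ)]
    gcongr
    exact norm_sub_le_of_le (hg _) (hg _)
  refine squeeze_zero_norm hbound ?_
  have hgeom := tendsto_pow_atTop_nhds_zero_of_lt_one (inv_nonneg.2 (Real.sqrt_nonneg 2))
    (inv_lt_one_of_one_lt₀ (Real.one_lt_sqrt_two))
  simpa using hgeom.mul_const (B + B)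

end SingularSequence

section Bands

variable {A α : ℝ} {z : ℂ}

theorem exists_multiplier {c t : ℝ} (ht : |t| ≤ |c|) :
    ∃ l : ℂ, ‖l‖ = 1 ∧ (c : ℂ) * (l + l⁻¹) = 2 * t := by
  rcases eq_or_ne c 0 with rfl | hc
  · exact ⟨1, norm_one, by simp [abs_nonpos_iff.1 (ht.trans_eq abs_zero)]⟩
  · have hratio : |t / c| ≤ 1 := by
      rw [abs_div]
      exact div_le_one_of_le₀ ht (abs_nonneg _)
    refine ⟨Complex.exp (Real.arccos (t / c) * Complex.I), Complex.norm_exp_ofReal_mul_I _, ?_⟩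
    rw [← Complex.exp_neg, ← neg_mul, ← Complex.two_cos, ← Complex.ofReal_cos,
      Real.cos_arccos (abs_le.1 hratio).1 (abs_le.1 hratio).2]
    have hc' : (c : ℂ) ≠ 0 := by exact_mod_cast hc
    push_cast
    field_simp

/-- The boundary term at `k` of a cut off plane wave with multiplier `l`. -/
def waveFlux (c : ℝ) (l : ℂ) (k : ℤ) : Seq :=
  (c : ℂ) • (l ^ (k - 1) • lp.single 2 k (1 : ℂ) - l ^ k • lp.single 2 (k - 1) (1 : ℂ))

theorem jacobi_single {l : ℂ} (hl : l ≠ 0) (γ : ℝ)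
    (h : Real.cos (A * Real.pi) * (l + l⁻¹) = 2 * discr α z) {k : ℤ} (hk : k ≠ 1) :
    jacobi A α γ z (l ^ k • lp.single 2 k (1 : ℂ)) =
      waveFlux (Real.cos (A * Real.pi)) l (k + 1) - waveFlux (Real.cos (A * Real.pi)) l k := by
  have hpred : l ^ (k - 1) = l ^ k * l⁻¹ := zpow_sub_one₀ hl k
  have hsucc : l ^ (k + 1) = l ^ k * l := zpow_add_one₀ hl k
  ext j
  rw [jacobi_apply, lp.coeFn_sub, Pi.sub_apply]
  simp only [waveFlux, Seq.smul_apply, lp.coeFn_sub, Pi.sub_apply, lp.single_apply, Pi.single_apply,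
    add_sub_cancel_right, hpred, hsucc, ← eq_sub_iff_add_eq, sub_eq_iff_eq_add]
  rcases eq_or_ne j k with rfl | hjk
  · rw [impurityCoupling, if_neg hk]
    rw [discr] at h
    simp only [if_true, mul_one]
    linear_combination l ^ j * h
  · simp only [if_neg hjk]
    ring

theorem not_isClosed_range_jacobi (γ : ℝ) {t : ℝ} (ht : |t| ≤ |Real.cos (A * Real.pi)|)
    (hz : discr α z = t) [FiniteDimensional ℂ (LinearMap.ker (jacobi A α γ z : Seq →ₗ[ℂ] Seq))] :
    ¬IsClosed (LinearMap.range (jacobi A α γ z : Seq →ₗ[ℂ] Seq) : Set Seq) := by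
  obtain ⟨l, hl, hlt⟩ := exists_multiplier ht
  have hl₀ : l ≠ 0 := norm_ne_zero_iff.1 (hl ▸ one_ne_zero)
  have hv : Orthonormal ℂ fun k : ℕ => (l ^ (k + 2 : ℤ) • lp.single 2 (k + 2 : ℤ) 1 : Seq) := by
    rw [orthonormal_iff_ite]
    intro m n
    rw [inner_smul_left, inner_smul_right, lp.inner_single_left, lp.single_apply]
    rcases eq_or_ne m n with rfl | hmn
    · simp only [Pi.single_eq_same, inner_self_eq_norm_sq_to_K, norm_one, if_true, ← mul_assoc,
        Complex.conj_mul', norm_zpow, hl, one_zpow]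
      norm_num
    · simp [hmn]
  refine not_isClosed_range_of_telescoping hv (B := |Real.cos (A * Real.pi)| * (1 + 1))
    (g := fun k => waveFlux (Real.cos (A * Real.pi)) l (k + 2)) (fun k => ?_) fun k => ?_
  · rw [waveFlux, norm_smul, Complex.norm_real, Real.norm_eq_abs]
    gcongr
    refine norm_sub_le_of_le ?_ ?_ <;> simp [norm_smul, hl]
  · have hk : (k + 2 : ℤ) ≠ 1 := by omega
    exact (jacobi_single hl₀ γ (hlt.trans (by rw [hz])) hk).trans (by push_cast; ring_nf)

theorem mem_essentialSpectrum_of_sinEnd_ne_zero (hz : sinEnd z ≠ 0) (γ : ℝ)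
    {t : ℝ} (ht : |t| ≤ |Real.cos (A * Real.pi)|) (hzt : discr α z = t) :
    z ∈ essentialSpectrum (hamiltonian A (impurityCoupling α γ)) := by
  rintro ⟨hker, hrange, -⟩
  obtain ⟨hker', hrange'⟩ := (isReduction_trace hz A α γ).finite_ker_and_isClosed_range
    (source_surjective hz A) hker hrange
  exact not_isClosed_range_jacobi γ ht hzt hrange'

end Bands

section FlatBands

variable {A : ℝ} {z : ℂ}

/-- The slopes of an eigenfunction which vanishes at all vertices and lives on the rings `N` and
`N + 1`. -/
def flatSlope (A : ℝ) (z : ℂ) (N : ℤ) (s : Fin 2) (j : ℤ) : ℂ :=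
  if j = N then ![1, -1] s else if j = N + 1 then
    ![-(phase (-potential A 1) Real.pi * cosEnd z), phase (-potential A 0) Real.pi * cosEnd z] s
  else 0

theorem moment_zero (A : ℝ) (χ : ℝ → ℂ) (s : Fin 2) (j : ℤ) : moment A χ s j 0 = 0 := by
  simpa using moment_smul A χ s j 0 0

theorem vertexEquations_flatSlope (hz : sinEnd z = 0) (β : ℤ → ℝ) (N : ℤ) :
    VertexEquations A β z 0 0 (flatSlope A z N) := by
  refine ⟨fun s j => by simp [hz, moment_zero], fun j => ?_⟩
  simp only [hz, moment_zero, Fin.sum_univ_two, Pi.zero_apply, mul_zero, neg_zero, zero_add,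
    sub_zero, flatSlope]
  rcases eq_or_ne j N with rfl | hN
  · simp [show j - 1 ≠ j + 1 by omega]
  rcases eq_or_ne j (N + 1) with rfl | hN'
  · simp only [add_eq_left, one_ne_zero, if_false, if_true, add_sub_cancel_right,
      Matrix.cons_val_zero, Matrix.cons_val_one]
    ring
  rcases eq_or_ne j (N + 1 + 1) with rfl | hN''
  · simp only [show N + 1 + 1 ≠ N by omega, add_eq_left, one_ne_zero, if_false, if_true,
      add_sub_cancel_right, Matrix.cons_val_zero, Matrix.cons_val_one]
    ring
  · simp [hN, hN', show j - 1 ≠ N by omega, show j - 1 ≠ N + 1 by omega]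

theorem exists_mem_eigenspace_flatSlope (hz : sinEnd z = 0) (β : ℤ → ℝ) (N : ℤ) :
    ∃ x ∈ eigenspace (hamiltonian A β) z, (vertexData A β x).2 = flatSlope A z N := by
  have hsummable : ∀ s, Summable fun j => ‖flatSlope A z N s j‖ ^ 2 := fun s =>
    summable_of_ne_finset_zero (s := {N, N + 1}) fun j hj => by
      simp only [Finset.mem_insert, Finset.mem_singleton, not_or] at hj
      simp [flatSlope, hj.1, hj.2]
  obtain ⟨x, hx, hdata⟩ := exists_vertexData_eq (vertexEquations_flatSlope (A := A) hz β N)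
    (by simp) hsummable
  exact ⟨x, hx, congrArg Prod.snd hdata⟩

theorem mem_essentialSpectrum_of_sinEnd_eq_zero (hz : sinEnd z = 0) (β : ℤ → ℝ) :
    z ∈ essentialSpectrum (hamiltonian A β) := by
  rintro ⟨hker, -⟩
  have : FiniteDimensional ℂ (eigenspace (hamiltonian A β) z) := hker
  choose x hx hflat using fun n : ℕ => exists_mem_eigenspace_flatSlope (A := A) hz β (2 * n)
  set upperSlopes : eigenspace (hamiltonian A β) z →ₗ[ℂ] ℕ → ℂ :=
    LinearMap.pi fun m => (LinearMap.proj (2 * m : ℤ)).comp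
      ((LinearMap.proj (0 : Fin 2)).comp ((LinearMap.snd ℂ _ _).comp
        ((vertexData A β).comp (Submodule.subtype _))))
  have hsingle : ∀ n, upperSlopes ⟨x n, hx n⟩ = Pi.single n 1 := fun n => by
    ext m
    simp only [upperSlopes, LinearMap.pi_apply, LinearMap.comp_apply, Submodule.subtype_apply,
      LinearMap.snd_apply, LinearMap.proj_apply, hflat, flatSlope, Pi.single_apply]
    simp [show (2 * m : ℤ) ≠ 2 * n + 1 by omega]
  have hindep : LinearIndependent ℂ fun n => (⟨x n, hx n⟩ : eigenspace (hamiltonian A β) z) := by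
    refine .of_comp upperSlopes ?_
    simpa only [Function.comp_def, hsingle] using Pi.linearIndependent_single_one ℕ ℂ
  exact Module.Finite.not_linearIndependent_of_infinite _ hindep

end FlatBands

section Conclusion

theorem impurityCoupling_zero (α : ℝ) : impurityCoupling α 0 = periodicCoupling α := by
  funext j
  simp [impurityCoupling, periodicCoupling]

theorem essentialSpectrum_subset_spectrumSet {H : Type*} [NormedAddCommGroup H]
    [InnerProductSpace ℂ H] (T : H →ₗ.[ℂ] H) : essentialSpectrum T ⊆ spectrumSet T := by
  rintro z hz ⟨⟨hinj, hsurj⟩, -⟩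
  refine hz ⟨?_, ?_, ?_⟩
  · rw [LinearMap.ker_eq_bot.2 hinj]
    infer_instance
  · rw [LinearMap.range_eq_top.2 hsurj]
    exact isClosed_univ
  · rw [LinearMap.range_eq_top.2 hsurj]
    infer_instance

theorem essentialSpectrum_impurityCoupling (A α γ : ℝ) :
    essentialSpectrum (hamiltonian A (impurityCoupling α γ)) = bandSet A α := by
  refine Subset.antisymm (fun z => not_imp_not.1 (notMem_essentialSpectrum γ)) fun z hz => ?_
  by_cases hsin : sinEnd z = 0
  · exact mem_essentialSpectrum_of_sinEnd_eq_zero hsin _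
  · obtain ⟨t, ht, hzt⟩ := hz.resolve_left hsin
    exact mem_essentialSpectrum_of_sinEnd_ne_zero hsin γ ht hzt

theorem spectrumSet_periodicCoupling (A α : ℝ) :
    spectrumSet (hamiltonian A (periodicCoupling α)) = bandSet A α := by
  rw [← impurityCoupling_zero]
  refine Subset.antisymm (fun z => not_imp_not.1 (notMem_spectrumSet A α)) ?_
  rw [← essentialSpectrum_impurityCoupling A α 0]
  exact essentialSpectrum_subset_spectrumSet _

end Conclusion

/-! ### Eigenvalues off the bands -/

section Decaying

theorem summable_sq_norm_pow_natAbs {l : ℂ} (hl : ‖l‖ < 1) :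
    Summable fun j : ℤ => ‖l ^ (j - 1).natAbs‖ ^ 2 := by
  have hgeom : Summable fun n : ℕ => (‖l‖ ^ 2) ^ n :=
    summable_geometric_of_lt_one (sq_nonneg _) (pow_lt_one₀ (norm_nonneg l) hl two_ne_zero)
  have hint : Summable fun j : ℤ => (‖l‖ ^ 2) ^ j.natAbs := by
    refine .of_nat_of_neg ?_ ?_ <;> simpa using hgeom
  refine ((Equiv.subRight (1 : ℤ)).summable_iff.2 hint).congr fun j => ?_
  simp only [Function.comp, Equiv.subRight_apply, norm_pow, ← pow_mul, mul_comm]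

/-- The solution of the Jacobi equation off the impurity which decays with the multiplier `l` on
both sides. -/
def decaying (l : ℂ) (hl : ‖l‖ < 1) : Seq :=
  Seq.mk (fun j => l ^ (j - 1).natAbs) (summable_sq_norm_pow_natAbs hl)

theorem decaying_apply_one (l : ℂ) (hl : ‖l‖ < 1) : decaying l hl 1 = 1 := by
  simp [decaying]

variable {A α γ : ℝ} {z l : ℂ}

theorem jacobi_decaying (hl : ‖l‖ < 1)
    (hroot : Real.cos (A * Real.pi) * (l ^ 2 + 1) = 2 * discr α z * l) :
    jacobi A α γ z (decaying l hl) =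
      lp.single 2 1 (2 * (Real.cos (A * Real.pi) * l - discr α z) - γ / 2 * sinEnd z) := by
  rw [discr] at hroot
  refine lp.ext (funext fun j => ?_)
  rw [jacobi_apply, lp.single_apply, discr, impurityCoupling]
  simp only [decaying, Seq.mk_apply]
  rcases eq_or_ne j 1 with rfl | hj
  · norm_num
    ring
  · have hnatAbs : ∃ n : ℕ, (j - 1).natAbs = n + 1 ∧
        ((j + 1 - 1).natAbs = n + 2 ∧ (j - 1 - 1).natAbs = n ∨
          (j + 1 - 1).natAbs = n ∧ (j - 1 - 1).natAbs = n + 2) :=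
      ⟨(j - 1).natAbs - 1, by omega, by omega⟩
    obtain ⟨n, hn, ⟨hright, hleft⟩ | ⟨hright, hleft⟩⟩ := hnatAbs <;>
    · rw [hn, hright, hleft, if_neg hj, Pi.single_eq_of_ne hj]
      linear_combination l ^ n * hroot

theorem jacobi_zero_apply_of_jacobi_eq_zero {x : Seq} (hx : jacobi A α γ z x = 0) :
    jacobi A α 0 z x = lp.single 2 1 (γ / 2 * sinEnd z * x 1) := by
  rw [jacobi_eq_sub, sub_apply, sub_eq_zero] at hx
  rw [hx, smul_apply, proj_apply, ← lp.single_smul, smul_eq_mul]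

theorem apply_one_ne_zero_of_jacobi_eq_zero (hz : z ∉ bandSet A α) {x : Seq}
    (hx : jacobi A α γ z x = 0) (hne : x ≠ 0) : x 1 ≠ 0 := fun hone =>
  hne <| (isInvertible_jacobi hz).injective <| by
    simp [jacobi_zero_apply_of_jacobi_eq_zero hx, hone]

theorem ker_jacobi_ne_bot_iff (hz : z ∉ bandSet A α) (hl : ‖l‖ < 1)
    (hroot : Real.cos (A * Real.pi) * (l ^ 2 + 1) = 2 * discr α z * l) :
    LinearMap.ker (jacobi A α γ z : Seq →ₗ[ℂ] Seq) ≠ ⊥ ↔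
      γ / 4 * sinEnd z = Real.cos (A * Real.pi) * l - discr α z := by
  rw [Submodule.ne_bot_iff]
  constructor
  · rintro ⟨x, hx : jacobi A α γ z x = 0, hne⟩
    have hmul : (2 * (Real.cos (A * Real.pi) * l - discr α z)) • x
        = (γ / 2 * sinEnd z * x 1) • decaying l hl :=
      (isInvertible_jacobi hz).injective <| by
        rw [map_smul, map_smul, jacobi_zero_apply_of_jacobi_eq_zero hx, jacobi_decaying hl hroot,
          ← lp.single_smul, ← lp.single_smul]
        simp [mul_comm]
    have hone := congrArg (fun y : Seq => y 1) hmul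
    simp only [Seq.smul_apply, decaying_apply_one] at hone
    refine mul_right_cancel₀ (apply_one_ne_zero_of_jacobi_eq_zero hz hx hne) ?_
    linear_combination -hone / 2
  · refine fun h => ⟨decaying l hl, ?_, fun hzero => ?_⟩
    · rw [LinearMap.mem_ker, ContinuousLinearMap.coe_coe, jacobi_decaying hl hroot, ← h]
      convert (lp.singleContinuousLinearMap ℂ (fun _ : ℤ => ℂ) 2 1).map_zero using 1
      congr 1
      ring
    · simpa [hzero] using decaying_apply_one l hl

theorem finrank_ker_jacobi_le_one (hz : z ∉ bandSet A α) :
    Module.finrank ℂ (LinearMap.ker (jacobi A α γ z : Seq →ₗ[ℂ] Seq)) ≤ 1 := by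
  set evalOne : LinearMap.ker (jacobi A α γ z : Seq →ₗ[ℂ] Seq) →ₗ[ℂ] ℂ :=
    (lp.evalCLM ℂ (fun _ : ℤ => ℂ) 2 1 : Seq →ₗ[ℂ] ℂ).comp (Submodule.subtype _)
  have hinj : Function.Injective evalOne := (injective_iff_map_eq_zero _).2 fun x hx => by
    by_contra hne
    exact apply_one_ne_zero_of_jacobi_eq_zero hz x.2 (fun h => hne (Subtype.ext h)) hx
  simpa using LinearMap.finrank_le_finrank_of_injective hinj

end Decaying

section Eigenspace

variable {A α γ : ℝ} {z : ℂ}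

theorem eigenspace_ne_bot_iff (hz : z ∉ bandSet A α) :
    eigenspace (hamiltonian A (impurityCoupling α γ)) z ≠ ⊥ ↔
      LinearMap.ker (jacobi A α γ z : Seq →ₗ[ℂ] Seq) ≠ ⊥ := by
  rw [← Submodule.nontrivial_iff_ne_bot, ← Submodule.nontrivial_iff_ne_bot]
  exact (isReduction_trace (fun h => hz (.inl h)) A α γ).kerEquiv.toEquiv.nontrivial_congr

theorem finrank_eigenspace_eq_one (hz : z ∉ bandSet A α)
    (hne : eigenspace (hamiltonian A (impurityCoupling α γ)) z ≠ ⊥) :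
    Module.finrank ℂ (eigenspace (hamiltonian A (impurityCoupling α γ)) z) = 1 := by
  have := (isFredholm_jacobi γ hz).finite_ker
  have hequiv := (isReduction_trace (fun h => hz (.inl h)) A α γ).kerEquiv.finrank_eq
  refine le_antisymm (hequiv.trans_le (finrank_ker_jacobi_le_one hz)) (hequiv.trans_ge ?_)
  rw [Nat.one_le_iff_ne_zero, Ne, Submodule.finrank_eq_zero]
  exact (eigenspace_ne_bot_iff hz).1 hne

end Eigenspace

/-! ### The discriminant on the real line -/

section RealDiscriminant

variable {E : ℝ}

/-- The value of `cosEnd` at a real energy. -/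
def cosR (E : ℝ) : ℝ :=
  if 0 ≤ E then Real.cos (Real.pi * √E) else Real.cosh (Real.pi * √(-E))

/-- The value of `sinEnd` at a real energy; `dslope` fills in the removable singularity at the
energy `0`. -/
def sinR (E : ℝ) : ℝ :=
  if 0 ≤ E then Real.pi * dslope Real.sin 0 (Real.pi * √E)
  else Real.pi * dslope Real.sinh 0 (Real.pi * √(-E))

theorem continuous_dslope_self {f : ℝ → ℝ} {a : ℝ} (hf : Differentiable ℝ f) :
    Continuous (dslope f a) := by
  rw [← continuousOn_univ, continuousOn_dslope Filter.univ_mem]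
  exact ⟨hf.continuous.continuousOn, hf a⟩

theorem continuous_cosR : Continuous cosR := by
  refine Continuous.if_le (by fun_prop) (by fun_prop) continuous_const continuous_id ?_
  rintro E rfl
  simp

theorem continuous_sinR : Continuous sinR := by
  have hsin := continuous_dslope_self (a := 0) Real.differentiable_sin
  have hsinh := continuous_dslope_self (a := 0) Real.differentiable_sinh
  refine Continuous.if_le (by fun_prop) (by fun_prop) continuous_const continuous_id ?_
  rintro E rfl
  simp [dslope_same]

theorem cosR_of_nonneg (h : 0 ≤ E) : cosR E = Real.cos (Real.pi * √E) := if_pos h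

theorem cosR_of_neg (h : E < 0) : cosR E = Real.cosh (Real.pi * √(-E)) := if_neg h.not_ge

theorem sqrt_mul_sinR (h : 0 ≤ E) : √E * sinR E = Real.sin (Real.pi * √E) := by
  have hslope := sub_smul_dslope Real.sin 0 (Real.pi * √E)
  rw [sub_zero, Real.sin_zero, sub_zero, smul_eq_mul] at hslope
  rw [sinR, if_pos h, ← hslope]
  ring

theorem sqrt_neg_mul_sinR (h : E < 0) : √(-E) * sinR E = Real.sinh (Real.pi * √(-E)) := by
  have hslope := sub_smul_dslope Real.sinh 0 (Real.pi * √(-E))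
  rw [sub_zero, Real.sinh_zero, sub_zero, smul_eq_mul] at hslope
  rw [sinR, if_neg h.not_ge, ← hslope]
  ring

theorem sinR_zero : sinR 0 = Real.pi := by simp [sinR, dslope_same]

theorem sq_ofReal_sqrt (h : 0 ≤ E) : ((√E : ℝ) : ℂ) ^ 2 = E := by
  exact_mod_cast Real.sq_sqrt h

theorem sq_ofReal_sqrt_neg_mul_I (h : E < 0) : ((√(-E) : ℝ) * Complex.I : ℂ) ^ 2 = E := by
  rw [mul_pow, Complex.I_sq, sq_ofReal_sqrt (neg_pos.2 h).le]
  simp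

theorem cosEnd_ofReal (E : ℝ) : cosEnd E = cosR E := by
  rcases le_or_gt 0 E with h | h
  · rw [cosEnd, csol_eq_cos (sq_ofReal_sqrt h), cosR_of_nonneg h, mul_comm]
    norm_cast
  · rw [cosEnd, csol_eq_cos (sq_ofReal_sqrt_neg_mul_I h), cosR_of_neg h, mul_right_comm,
      Complex.cos_mul_I, mul_comm]
    norm_cast

theorem sinEnd_ofReal (E : ℝ) : sinEnd E = sinR E := by
  rcases lt_trichotomy 0 E with h | rfl | h
  · have hroot : ((√E : ℝ) : ℂ) ≠ 0 := by exact_mod_cast (Real.sqrt_pos.2 h).ne'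
    refine mul_left_cancel₀ hroot ?_
    rw [sinEnd, mul_ssol_eq_sin (sq_ofReal_sqrt h.le), mul_comm]
    exact_mod_cast (sqrt_mul_sinR h.le).symm
  · simp [sinEnd, ssol, sinR_zero]
  · have hroot : ((√(-E) : ℝ) * Complex.I : ℂ) ≠ 0 :=
      mul_ne_zero (by exact_mod_cast (Real.sqrt_pos.2 (neg_pos.2 h)).ne') Complex.I_ne_zero
    refine mul_left_cancel₀ hroot ?_
    rw [sinEnd, mul_ssol_eq_sin (sq_ofReal_sqrt_neg_mul_I h), mul_right_comm, Complex.sin_mul_I,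
      mul_right_comm, mul_comm _ (Real.pi : ℂ)]
    congr 1
    exact_mod_cast (sqrt_neg_mul_sinR h).symm

/-- The discriminant at a real energy. -/
def discrR (α E : ℝ) : ℝ := cosR E + α / 4 * sinR E

theorem discr_ofReal (α E : ℝ) : discr α E = discrR α E := by
  rw [discr, cosEnd_ofReal, sinEnd_ofReal, discrR]
  push_cast
  ring

theorem continuous_discrR (α : ℝ) : Continuous (discrR α) :=
  continuous_cosR.add (continuous_const.mul continuous_sinR)

theorem ofReal_mem_bandSet {A α E : ℝ} :
    (E : ℂ) ∈ bandSet A α ↔ sinR E = 0 ∨ |discrR α E| ≤ |Real.cos (A * Real.pi)| := by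
  rw [bandSet, mem_ofPred_eq, sinEnd_ofReal, discr_ofReal, Complex.ofReal_eq_zero]
  refine or_congr Iff.rfl ⟨?_, fun h => ⟨_, h, rfl⟩⟩
  rintro ⟨t, ht, heq⟩
  rwa [Complex.ofReal_injective heq]

theorem cosR_sq_add (E : ℝ) : cosR E ^ 2 + E * sinR E ^ 2 = 1 := by
  have h := csol_sq_add E Real.pi
  rw [← cosEnd, ← sinEnd, cosEnd_ofReal, sinEnd_ofReal] at h
  exact_mod_cast h

end RealDiscriminant

section DirichletWindows

/-- The energies between the Dirichlet eigenvalues `m ^ 2` and `(m + 1) ^ 2` of an edge, where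
the first window extends to `-∞` since `0` is not a Dirichlet eigenvalue. -/
def window (m : ℕ) : Set ℝ := {E | (m = 0 ∨ (m : ℝ) ^ 2 < E) ∧ E < ((m : ℝ) + 1) ^ 2}

theorem ordConnected_window (m : ℕ) : (window m).OrdConnected :=
  ⟨fun _ hx _ hy _ hz => ⟨hx.1.imp id fun h => h.trans_le hz.1, hz.2.trans_lt hy.2⟩⟩

theorem sinR_succ_sq (m : ℕ) : sinR (((m : ℝ) + 1) ^ 2) = 0 := by
  have hm : (0 : ℝ) < (m : ℝ) + 1 := by positivity
  have h := sqrt_mul_sinR (sq_nonneg ((m : ℝ) + 1))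
  rw [Real.sqrt_sq hm.le, mul_comm Real.pi, ← Nat.cast_succ, Real.sin_nat_mul_pi] at h
  exact_mod_cast (mul_eq_zero.1 h).resolve_left (by exact_mod_cast hm.ne')

theorem cosR_sq (m : ℕ) : cosR ((m : ℝ) ^ 2) = (-1) ^ m := by
  rw [cosR_of_nonneg (by positivity), Real.sqrt_sq (by positivity), mul_comm]
  exact Real.cos_nat_mul_pi m

theorem discrR_succ_sq (α : ℝ) (m : ℕ) : (-1) ^ m * discrR α (((m : ℝ) + 1) ^ 2) = -1 := by
  rw [discrR, sinR_succ_sq, ← Nat.cast_succ, cosR_sq, Nat.succ_eq_add_one, pow_succ, mul_zero,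
    add_zero, ← mul_assoc, ← mul_pow]
  simp

theorem pi_lt_sinR_of_neg {E : ℝ} (h : E < 0) : Real.pi < sinR E := by
  have hroot : 0 < √(-E) := Real.sqrt_pos.2 (neg_pos.2 h)
  have hsinh := Real.self_lt_sinh_iff.2 (mul_pos Real.pi_pos hroot)
  rw [← sqrt_neg_mul_sinR h, mul_comm] at hsinh
  exact lt_of_mul_lt_mul_left hsinh hroot.le

theorem abs_sinR_lt_pi_of_pos {E : ℝ} (h : 0 < E) : |sinR E| < Real.pi := by
  have hroot : 0 < √E := Real.sqrt_pos.2 h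
  have hsin := Real.abs_sin_lt_abs (mul_pos Real.pi_pos hroot).ne'
  rw [← sqrt_mul_sinR h.le, abs_mul, abs_of_pos hroot, abs_of_pos (mul_pos Real.pi_pos hroot),
    mul_comm] at hsin
  exact lt_of_mul_lt_mul_right hsin hroot.le

theorem sinR_pos_of_nonpos {E : ℝ} (h : E ≤ 0) : 0 < sinR E := by
  rcases h.eq_or_lt with rfl | h
  · exact sinR_zero ▸ Real.pi_pos
  · exact Real.pi_pos.trans (pi_lt_sinR_of_neg h)

theorem neg_one_pow_mul_sinR_pos {m : ℕ} {E : ℝ} (hE : E ∈ window m) : 0 < (-1) ^ m * sinR E := by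
  rcases le_or_gt E 0 with hneg | hpos
  · rcases hE.1 with rfl | hlow
    · simpa using sinR_pos_of_nonpos hneg
    · exact absurd hneg ((sq_nonneg _).trans_lt hlow).not_ge
  · have hroot : 0 < √E := Real.sqrt_pos.2 hpos
    have hlower : (m : ℝ) < √E := by
      rcases hE.1 with rfl | hlow
      · simpa using hroot
      · exact Real.lt_sqrt_of_sq_lt hlow
    have hupper : √E < m + 1 := (Real.sqrt_lt' (by positivity)).2 hE.2
    have hsin : 0 < Real.sin (Real.pi * √E - m * Real.pi) :=
      Real.sin_pos_of_pos_of_lt_pi (by nlinarith [Real.pi_pos]) (by nlinarith [Real.pi_pos])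
    rw [Real.sin_sub_nat_mul_pi, ← sqrt_mul_sinR hpos.le, mul_left_comm] at hsin
    exact pos_of_mul_pos_right hsin hroot.le

theorem sinR_ne_zero {m : ℕ} {E : ℝ} (hE : E ∈ window m) : sinR E ≠ 0 :=
  right_ne_zero_of_mul (neg_one_pow_mul_sinR_pos hE).ne'

theorem exists_mem_window (E : ℝ) : (∃ m, E ∈ window m) ∨ ∃ m : ℕ, E = ((m : ℝ) + 1) ^ 2 := by
  rcases lt_or_ge E 1 with h | h
  · exact Or.inl ⟨0, Or.inl rfl, by simpa using h⟩
  have hfloor : 1 ≤ ⌊√E⌋₊ := Nat.le_floor (by simpa using Real.one_le_sqrt.2 h)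
  rcases (Nat.floor_le (Real.sqrt_nonneg E)).eq_or_lt with heq | hlt
  · refine Or.inr ⟨⌊√E⌋₊ - 1, ?_⟩
    rw [Nat.cast_sub hfloor, Nat.cast_one, sub_add_cancel, heq, Real.sq_sqrt (by linarith)]
  · exact Or.inl ⟨⌊√E⌋₊, Or.inr ((Real.lt_sqrt (by positivity)).1 hlt),
      (Real.sqrt_lt' (by positivity)).1 (Nat.lt_floor_add_one √E)⟩

theorem succ_sq_lt_of_mem_window {m n : ℕ} (h : m < n) {y : ℝ} (hy : y ∈ window n) :
    ((m : ℝ) + 1) ^ 2 < y := by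
  refine lt_of_le_of_lt ?_ (hy.1.resolve_left (by omega))
  gcongr
  exact_mod_cast h

end DirichletWindows

/-! ### Monotonicity of the edge functions -/

section EdgeFunctions

variable {E σ : ℝ}

theorem hasDerivAt_cosR (hE : E ≠ 0) : HasDerivAt cosR (-(Real.pi / 2 * sinR E)) E := by
  rcases hE.lt_or_gt with h | h
  · have hroot : 0 < √(-E) := Real.sqrt_pos.2 (neg_pos.2 h)
    have hderiv := (((hasDerivAt_neg E).sqrt (neg_pos.2 h).ne').const_mul Real.pi).cosh
    rw [← sqrt_neg_mul_sinR h] at hderiv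
    refine (hderiv.congr_of_eventuallyEq ?_).congr_deriv (by field_simp)
    filter_upwards [gt_mem_nhds h] with x hx using cosR_of_neg hx
  · have hderiv := ((Real.hasDerivAt_sqrt hE).const_mul Real.pi).cos
    rw [← sqrt_mul_sinR h.le] at hderiv
    refine (hderiv.congr_of_eventuallyEq ?_).congr_deriv (by field_simp)
    filter_upwards [lt_mem_nhds h] with x hx using cosR_of_nonneg hx.le

theorem hasDerivAt_sinR (hE : E ≠ 0) :
    HasDerivAt sinR ((Real.pi * cosR E - sinR E) / (2 * E)) E := by
  rcases hE.lt_or_gt with h | h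
  · have hroot : 0 < √(-E) := Real.sqrt_pos.2 (neg_pos.2 h)
    have hsqrt := (hasDerivAt_neg E).sqrt (neg_pos.2 h).ne'
    have hderiv := ((hsqrt.const_mul Real.pi).sinh).div hsqrt hroot.ne'
    rw [← sqrt_neg_mul_sinR h, ← cosR_of_neg h] at hderiv
    refine (hderiv.congr_of_eventuallyEq ?_).congr_deriv ?_
    · filter_upwards [gt_mem_nhds h] with x hx
      rw [Pi.div_apply, ← sqrt_neg_mul_sinR hx,
        mul_div_cancel_left₀ _ (Real.sqrt_pos.2 (neg_pos.2 hx)).ne']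
    · rw [Real.sq_sqrt (neg_pos.2 h).le]
      field_simp
      ring
  · have hroot : 0 < √E := Real.sqrt_pos.2 h
    have hsqrt := Real.hasDerivAt_sqrt hE
    have hderiv := ((hsqrt.const_mul Real.pi).sin).div hsqrt hroot.ne'
    rw [← sqrt_mul_sinR h.le, ← cosR_of_nonneg h.le] at hderiv
    refine (hderiv.congr_of_eventuallyEq ?_).congr_deriv ?_
    · filter_upwards [lt_mem_nhds h] with x hx
      rw [Pi.div_apply, ← sqrt_mul_sinR hx.le, mul_div_cancel_left₀ _ (Real.sqrt_pos.2 hx).ne']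
    · rw [Real.sq_sqrt h.le]
      field_simp

/-- The function of the energy whose zeros between the Dirichlet eigenvalues are the solutions of
`discrR α E = -σ`. -/
def edgeFun (α σ E : ℝ) : ℝ := (cosR E + σ) / sinR E + α / 4

theorem edgeFun_mul_sinR {α : ℝ} (hS : sinR E ≠ 0) :
    edgeFun α σ E * sinR E = discrR α E + σ := by
  rw [edgeFun, discrR]
  field_simp
  ring

theorem hasDerivAt_edgeFun (α σ : ℝ) (hE : E ≠ 0) (hS : sinR E ≠ 0) :
    HasDerivAt (edgeFun α σ)
      (-(E * (Real.pi * (1 + σ * cosR E) - (cosR E + σ) * sinR E)) / (2 * E ^ 2 * sinR E ^ 2))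
      E := by
  refine ((((hasDerivAt_cosR hE).add_const σ).div (hasDerivAt_sinR hE) hS).add_const
    (α / 4)).congr_deriv ?_
  field_simp
  linear_combination -Real.pi * cosR_sq_add E

theorem mul_sub_mul_sinR_pos (hσ : |σ| < 1) (hE : E ≠ 0) (hS : sinR E ≠ 0) :
    0 < E * (Real.pi * (1 + σ * cosR E) - (cosR E + σ) * sinR E) := by
  have hsplit : 2 * (Real.pi * (1 + σ * cosR E) - (cosR E + σ) * sinR E) =
      (1 + σ) * (1 + cosR E) * (Real.pi - sinR E)
        + (1 - σ) * (1 - cosR E) * (Real.pi + sinR E) := by ring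
  obtain ⟨hσ_gt, hσ_lt⟩ := abs_lt.1 hσ
  rcases hE.lt_or_gt with h | h
  · have hsin := pi_lt_sinR_of_neg h
    have hcos : 1 < cosR E := by
      rw [cosR_of_neg h]
      exact Real.one_lt_cosh.2 (mul_pos Real.pi_pos (Real.sqrt_pos.2 (neg_pos.2 h))).ne'
    refine mul_pos_of_neg_of_neg h ?_
    have hfirst : 0 < (1 + σ) * (1 + cosR E) * (sinR E - Real.pi) :=
      mul_pos (mul_pos (by linarith) (by linarith)) (by linarith)
    have hsecond : 0 < (1 - σ) * (cosR E - 1) * (Real.pi + sinR E) :=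
      mul_pos (mul_pos (by linarith) (by linarith)) (by linarith [Real.pi_pos])
    linarith [hsplit]
  · obtain ⟨hsin_gt, hsin_lt⟩ := abs_lt.1 (abs_sinR_lt_pi_of_pos h)
    obtain ⟨hcos_gt, hcos_lt⟩ : -1 < cosR E ∧ cosR E < 1 := by
      rw [← abs_lt, ← sq_lt_one_iff_abs_lt_one, ← cosR_sq_add E]
      have := mul_pos h (sq_pos_of_ne_zero hS)
      linarith
    refine mul_pos h ?_
    have hfirst : 0 < (1 + σ) * (1 + cosR E) * (Real.pi - sinR E) :=
      mul_pos (mul_pos (by linarith) (by linarith)) (by linarith)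
    have hsecond : 0 < (1 - σ) * (1 - cosR E) * (Real.pi + sinR E) :=
      mul_pos (mul_pos (by linarith) (by linarith)) (by linarith)
    linarith [hsplit]

theorem deriv_edgeFun_neg (α : ℝ) (hσ : |σ| < 1) (hE : E ≠ 0) (hS : sinR E ≠ 0) :
    deriv (edgeFun α σ) E < 0 := by
  rw [(hasDerivAt_edgeFun α σ hE hS).deriv]
  exact div_neg_of_neg_of_pos (neg_neg_of_pos (mul_sub_mul_sinR_pos hσ hE hS)) (by positivity)

theorem continuousOn_edgeFun (α σ : ℝ) (m : ℕ) : ContinuousOn (edgeFun α σ) (window m) :=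
  ((continuous_cosR.add continuous_const).continuousOn.div continuous_sinR.continuousOn
    fun _ hE => sinR_ne_zero hE).add continuousOn_const

theorem strictAntiOn_edgeFun_of_subset (α : ℝ) (hσ : |σ| < 1) {m : ℕ} {D : Set ℝ}
    (hD : Convex ℝ D) (hsub : D ⊆ window m) (hzero : 0 ∉ interior D) :
    StrictAntiOn (edgeFun α σ) D :=
  strictAntiOn_of_deriv_neg hD ((continuousOn_edgeFun α σ m).mono hsub) fun _ hE =>
    deriv_edgeFun_neg α hσ (fun h => hzero (h ▸ hE)) (sinR_ne_zero (hsub (interior_subset hE)))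

theorem window_zero : window 0 = Iic 0 ∪ Ico 0 1 := by
  rw [Iic_union_Ico_eq_Iio zero_lt_one]
  ext E
  simp [window]

theorem strictAntiOn_edgeFun (α : ℝ) (hσ : |σ| < 1) (m : ℕ) :
    StrictAntiOn (edgeFun α σ) (window m) := by
  rcases Nat.eq_zero_or_pos m with rfl | hm
  · have hleft : Iic 0 ⊆ window 0 := window_zero ▸ subset_union_left
    have hright : Ico 0 1 ⊆ window 0 := window_zero ▸ subset_union_right
    rw [window_zero]
    refine .union ?_ ?_ isGreatest_Iic (isLeast_Ico zero_lt_one)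
    · exact strictAntiOn_edgeFun_of_subset α hσ (convex_Iic 0) hleft (by simp)
    · exact strictAntiOn_edgeFun_of_subset α hσ (convex_Ico 0 1) hright (by simp)
  · refine strictAntiOn_edgeFun_of_subset α hσ (ordConnected_window m).convex subset_rfl fun h => ?_
    exact ((interior_subset h).1.resolve_left hm.ne').not_ge (sq_nonneg _)

end EdgeFunctions

/-! ### The gaps -/

section Gaps

variable {α c : ℝ} {m n : ℕ}

theorem sqrt_neg_mul_sinR_lt_cosR {E : ℝ} (h : E < 0) : √(-E) * sinR E < cosR E := by
  rw [sqrt_neg_mul_sinR h, cosR_of_neg h]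
  exact Real.sinh_lt_cosh _

theorem exists_lt_discrR_zero (α b κ : ℝ) : ∃ l < 0, |b| + |κ| * |sinR l| < discrR α l := by
  set k := |α| / 4 + |κ| + |b|
  have hneg : -(k ^ 2 + 1) < 0 := neg_neg_of_pos (by positivity)
  refine ⟨-(k ^ 2 + 1), hneg, ?_⟩
  have hroot : k ≤ √(-(-(k ^ 2 + 1))) := Real.le_sqrt_of_sq_le (by linarith)
  have hS : 1 < sinR (-(k ^ 2 + 1)) := by linarith [Real.pi_gt_three, pi_lt_sinR_of_neg hneg]
  have hdom := sqrt_neg_mul_sinR_lt_cosR hneg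
  have hk := mul_le_mul_of_nonneg_right hroot (zero_le_one.trans hS.le)
  have hb := mul_le_mul_of_nonneg_left hS.le (abs_nonneg b)
  have hα := mul_le_mul_of_nonneg_right (neg_abs_le α) (zero_le_one.trans hS.le)
  rw [abs_of_pos (zero_lt_one.trans hS), discrR]
  simp only [k] at *
  linarith

theorem exists_left_point (α κ : ℝ) (hc : |c| < 1) (m : ℕ) :
    ∃ l < ((m : ℝ) + 1) ^ 2, Ioo l (((m : ℝ) + 1) ^ 2) ⊆ window m ∧
      |c| + |κ| * |sinR l| < (-1) ^ m * discrR α l := by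
  rcases m with _ | m
  · obtain ⟨l, hl, hlt⟩ := exists_lt_discrR_zero α c κ
    exact ⟨l, hl.trans (by positivity), fun x hx => ⟨.inl rfl, hx.2⟩, by simpa using hlt⟩
  · refine ⟨((m + 1 : ℕ) : ℝ) ^ 2, by gcongr; exact lt_add_one _,
      fun x hx => ⟨.inr hx.1, hx.2⟩, ?_⟩
    rw [discrR, cosR_sq, Nat.cast_succ, sinR_succ_sq, abs_zero, mul_zero, mul_zero, add_zero,
      add_zero, ← mul_pow]
    simpa using hc

theorem exists_mem_window_discrR_eq (α κ : ℝ) (hc : |c| < 1) {g : ℝ → ℝ} (hg : Continuous g)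
    (hbound : ∀ E, |g E| ≤ |c| + |κ| * |sinR E|) (m : ℕ) :
    ∃ E ∈ window m, (-1) ^ m * discrR α E = g E := by
  obtain ⟨l, hl, hwindow, hleft⟩ := exists_left_point α κ hc m
  have hright := hbound (((m : ℝ) + 1) ^ 2)
  rw [sinR_succ_sq, abs_zero, mul_zero, add_zero] at hright
  have hcont : Continuous fun E => (-1) ^ m * discrR α E - g E :=
    (continuous_const.mul (continuous_discrR α)).sub hg
  have hsign : 0 ∈ Ioo ((-1) ^ m * discrR α (((m : ℝ) + 1) ^ 2) - g (((m : ℝ) + 1) ^ 2))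
      ((-1) ^ m * discrR α l - g l) :=
    ⟨by linarith [discrR_succ_sq α m, neg_abs_le (g (((m : ℝ) + 1) ^ 2))],
      by linarith [hbound l, le_abs_self (g l)]⟩
  obtain ⟨E, hE, hzero⟩ := intermediate_value_Ioo' hl.le hcont.continuousOn hsign
  exact ⟨E, hwindow hE, sub_eq_zero.1 hzero⟩

/-- The gaps in their order from the left to the right, where `c` is the hopping strength: each
window contains a gap of even number to the left of its band and one of odd number to the right. -/
def gap (α c : ℝ) (n : ℕ) : Set ℝ :=
  {E ∈ window (n / 2) | |c| < (-1) ^ n * ((-1) ^ (n / 2) * discrR α E)}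

theorem notMem_bandSet_iff_exists_mem_gap {A α E : ℝ} :
    (E : ℂ) ∉ bandSet A α ↔ ∃ n, E ∈ gap α (Real.cos (A * Real.pi)) n := by
  rw [ofReal_mem_bandSet, not_or, not_le]
  constructor
  · rintro ⟨hS, hlt⟩
    obtain ⟨m, hm⟩ := (exists_mem_window E).resolve_right fun ⟨m, hm⟩ => hS (hm ▸ sinR_succ_sq m)
    have habs : |discrR α E| = |(-1) ^ m * discrR α E| := by simp [abs_mul]
    rw [habs, lt_abs] at hlt
    rcases hlt with hlt | hlt
    · exact ⟨2 * m, by simpa [gap] using ⟨hm, hlt⟩⟩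
    · refine ⟨2 * m + 1, ?_⟩
      rw [gap, show (2 * m + 1) / 2 = m by omega]
      exact ⟨hm, by simpa [pow_succ] using hlt⟩
  · rintro ⟨n, hn⟩
    refine ⟨sinR_ne_zero hn.1, hn.2.trans_le ((le_abs_self _).trans_eq ?_)⟩
    simp [abs_mul]

theorem mem_gap_iff {E : ℝ} (hE : E ∈ window (n / 2)) :
    E ∈ gap α c n ↔ 0 < (-1) ^ n * edgeFun α c E ∧ 0 < (-1) ^ n * edgeFun α (-c) E := by
  have hedge : ∀ σ, 0 < (-1) ^ n * edgeFun α σ E ↔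
      0 < (-1) ^ n * ((-1) ^ (n / 2) * (discrR α E + σ)) := fun σ => by
    rw [← mul_pos_iff_of_pos_right (neg_one_pow_mul_sinR_pos hE), mul_assoc,
      mul_left_comm (edgeFun α σ E), edgeFun_mul_sinR (sinR_ne_zero hE)]
  rw [hedge, hedge, gap, mem_sep_iff, and_iff_right hE, abs_lt]
  rcases neg_one_pow_eq_or ℝ n with h | h <;> rcases neg_one_pow_eq_or ℝ (n / 2) with h' | h' <;>
    rw [h, h'] <;> constructor <;> rintro ⟨_, _⟩ <;> constructor <;> linarith

theorem edgeFun_mul_edgeFun {E : ℝ} (hS : sinR E ≠ 0) :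
    edgeFun α c E * edgeFun α (-c) E * sinR E ^ 2 = discrR α E ^ 2 - c ^ 2 := by
  calc edgeFun α c E * edgeFun α (-c) E * sinR E ^ 2
    _ = (edgeFun α c E * sinR E) * (edgeFun α (-c) E * sinR E) := by ring
    _ = discrR α E ^ 2 - c ^ 2 := by rw [edgeFun_mul_sinR hS, edgeFun_mul_sinR hS]; ring

theorem discrR_mul_sinR_pos {E : ℝ} (hE : E ∈ gap α c n) :
    0 < (-1) ^ n * (discrR α E * sinR E) := by
  have hsq : ((-1 : ℝ) ^ (n / 2)) ^ 2 = 1 := by simp [← pow_mul]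
  calc 0
    _ < (-1) ^ n * ((-1) ^ (n / 2) * discrR α E) * ((-1) ^ (n / 2) * sinR E) :=
      mul_pos ((abs_nonneg c).trans_lt hE.2) (neg_one_pow_mul_sinR_pos hE.1)
    _ = (-1) ^ n * (discrR α E * sinR E) := by
      linear_combination (-1) ^ n * (discrR α E * sinR E) * hsq

theorem ordConnected_gap (α : ℝ) (hc : |c| < 1) (n : ℕ) : (gap α c n).OrdConnected := by
  refine ⟨fun x hx y hy z hz => ?_⟩
  have hwindow := (ordConnected_window _).out hx.1 hy.1 hz
  have hbetween : ∀ σ, |σ| < 1 → 0 < (-1) ^ n * edgeFun α σ x → 0 < (-1) ^ n * edgeFun α σ y →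
      0 < (-1) ^ n * edgeFun α σ z := fun σ hσ hposx hposy => by
    have hanti := (strictAntiOn_edgeFun α hσ (n / 2)).antitoneOn
    have hxz := hanti hx.1 hwindow hz.1
    have hzy := hanti hwindow hy.1 hz.2
    rcases neg_one_pow_eq_or ℝ n with h | h <;> rw [h] at hposx hposy ⊢ <;> linarith
  obtain ⟨hx_pos, hx_neg⟩ := (mem_gap_iff hx.1).1 hx
  obtain ⟨hy_pos, hy_neg⟩ := (mem_gap_iff hy.1).1 hy
  exact (mem_gap_iff hwindow).2
    ⟨hbetween c hc hx_pos hy_pos, hbetween (-c) (by rwa [abs_neg]) hx_neg hy_neg⟩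

theorem exists_mem_gap_discrR_sq_eq (α : ℝ) {κ : ℝ} (hc : |c| < 1) (hκ : κ ≠ 0) (n : ℕ) :
    ∃ E ∈ gap α c n, discrR α E ^ 2 - c ^ 2 = κ ^ 2 * sinR E ^ 2 := by
  have hbound : ∀ E, |(-1) ^ n * √(c ^ 2 + κ ^ 2 * sinR E ^ 2)| ≤ |c| + |κ| * |sinR E| := by
    intro E
    rw [abs_mul, abs_neg_one_pow, one_mul, abs_of_nonneg (Real.sqrt_nonneg _)]
    refine Real.sqrt_le_iff.2 ⟨by positivity, ?_⟩
    rw [add_sq, sq_abs, mul_pow, sq_abs, sq_abs]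
    have : 0 ≤ 2 * |c| * (|κ| * |sinR E|) := by positivity
    linarith
  have hcont : Continuous fun E => (-1) ^ n * √(c ^ 2 + κ ^ 2 * sinR E ^ 2) := by
    have := continuous_sinR
    fun_prop
  obtain ⟨E, hE, heq⟩ := exists_mem_window_discrR_eq α κ hc hcont hbound (n / 2)
  have hS := sinR_ne_zero hE
  have hsq : ∀ k : ℕ, ((-1 : ℝ) ^ k) ^ 2 = 1 := fun k => by simp [← pow_mul]
  refine ⟨E, ⟨hE, ?_⟩, ?_⟩
  · rw [heq, ← mul_assoc, ← sq, hsq, one_mul, ← Real.sqrt_sq_eq_abs]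
    exact Real.sqrt_lt_sqrt (sq_nonneg c) (lt_add_of_pos_right _ (by positivity))
  · have hsquare := congrArg (· ^ 2) heq
    simp only [mul_pow, hsq, one_mul] at hsquare
    rw [hsquare, Real.sq_sqrt (by positivity), add_sub_cancel_left]

theorem exists_separator {A : ℝ} (hc : |Real.cos (A * Real.pi)| < 1) (α : ℝ) (n : ℕ) :
    ∃ b : ℝ, (b : ℂ) ∈ bandSet A α ∧ (∀ x ∈ gap α (Real.cos (A * Real.pi)) n, x < b) ∧
      ∀ k, n < k → ∀ y ∈ gap α (Real.cos (A * Real.pi)) k, b < y := by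
  set c := Real.cos (A * Real.pi)
  rcases Nat.even_or_odd' n with ⟨m, rfl | rfl⟩
  · obtain ⟨b, hb, hdiscr⟩ := exists_mem_window_discrR_eq α 0 hc
      (g := fun _ => -((-1) ^ m * c)) continuous_const (fun _ => by simp [abs_mul]) m
    have hzero : discrR α b + c = 0 := by
      refine (mul_eq_zero_iff_left (pow_ne_zero m (by norm_num : (-1 : ℝ) ≠ 0))).1 ?_
      linear_combination hdiscr
    have hedge : edgeFun α c b = 0 := by
      refine (mul_eq_zero_iff_right (sinR_ne_zero hb)).1 ?_
      rw [edgeFun_mul_sinR (sinR_ne_zero hb), hzero]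
    have hanti := strictAntiOn_edgeFun α hc m
    refine ⟨b, ofReal_mem_bandSet.2 (.inr ?_), fun x hx => ?_, fun k hk y hy => ?_⟩
    · rw [eq_neg_of_add_eq_zero_left hzero, abs_neg]
    · have hxm : x ∈ window m := by simpa using hx.1
      have hpos := ((mem_gap_iff hx.1).1 hx).1
      rw [pow_mul, neg_one_sq, one_pow, one_mul] at hpos
      exact (hanti.lt_iff_gt hb hxm).1 (hedge ▸ hpos)
    · rcases (show m ≤ k / 2 by omega).eq_or_lt with hm | hm
      · have hym : y ∈ window m := by simpa [hm] using hy.1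
        have hneg := ((mem_gap_iff hy.1).1 hy).1
        rw [show k = 2 * m + 1 by omega, pow_succ, pow_mul, neg_one_sq, one_pow] at hneg
        exact (hanti.lt_iff_gt hym hb).1 (by linarith)
      · exact hb.2.trans (succ_sq_lt_of_mem_window hm hy.1)
  · refine ⟨((m : ℝ) + 1) ^ 2, ofReal_mem_bandSet.2 (.inl (sinR_succ_sq m)), fun x hx => ?_,
      fun k hk y hy => succ_sq_lt_of_mem_window (by omega) hy.1⟩
    simpa [show (2 * m + 1) / 2 = m by omega] using hx.1.2

theorem isGapEnumeration_of_separated {S : Set ℂ} {G : ℕ → Set ℝ} (hne : ∀ n, (G n).Nonempty)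
    (hconn : ∀ n, (G n).OrdConnected) (hmem : ∀ y : ℝ, (y : ℂ) ∉ S ↔ ∃ n, y ∈ G n)
    (hsep : ∀ n, ∃ b : ℝ, (b : ℂ) ∈ S ∧ (∀ x ∈ G n, x < b) ∧ ∀ k, n < k → ∀ y ∈ G k, b < y) :
    IsGapEnumeration S G := by
  choose b hb hlt hgt using hsep
  have hcomponent : ∀ n, ∀ x ∈ G n, connectedComponentIn {y : ℝ | (y : ℂ) ∉ S} x = G n := by
    intro n x hx
    refine subset_antisymm (fun y hy => ?_) ((hconn n).isPreconnected.subset_connectedComponentIn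
      hx fun y hy => (hmem y).2 ⟨n, hy⟩)
    have hx_mem := mem_connectedComponentIn (F := {y : ℝ | (y : ℂ) ∉ S}) ((hmem x).2 ⟨n, hx⟩)
    have hord := (isPreconnected_connectedComponentIn (F := {y : ℝ | (y : ℂ) ∉ S})
      (x := x)).ordConnected
    have hsub := connectedComponentIn_subset {y : ℝ | (y : ℂ) ∉ S} x
    obtain ⟨k, hk⟩ := (hmem y).1 (hsub hy)
    rcases lt_trichotomy n k with h | rfl | h
    · exact absurd (hb n) (hsub (hord.out hx_mem hy ⟨(hlt n x hx).le, (hgt n k h y hk).le⟩))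
    · exact hk
    · exact absurd (hb k) (hsub (hord.out hy hx_mem ⟨(hlt k y hk).le, (hgt k n h x hx).le⟩))
  refine ⟨fun I => ⟨?_, ?_⟩, fun m n h x hx y hy => (hlt m x hx).trans (hgt m n h y hy)⟩
  · rintro ⟨x, hx, rfl⟩
    obtain ⟨n, hn⟩ := (hmem x).1 hx
    exact ⟨n, hcomponent n x hn⟩
  · rintro ⟨n, rfl⟩
    obtain ⟨x, hx⟩ := hne n
    exact ⟨x, (hmem x).2 ⟨n, hx⟩, (hcomponent n x hx).symm⟩

theorem isGapEnumeration_gap {A : ℝ} (α : ℝ) (hc : |Real.cos (A * Real.pi)| < 1) :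
    IsGapEnumeration (bandSet A α) (gap α (Real.cos (A * Real.pi))) :=
  isGapEnumeration_of_separated
    (fun n => (exists_mem_gap_discrR_sq_eq α hc one_ne_zero n).imp fun _ h => h.1)
    (ordConnected_gap α hc) (fun _ => notMem_bandSet_iff_exists_mem_gap) (exists_separator hc α)

end Gaps

/-! ### Eigenvalues in the gaps -/

section Eigenvalues

variable {A α γ c E : ℝ} {n : ℕ}

theorem exists_decaying_root {η : ℝ} (h : |c| < |η|) :
    ∃ l : ℝ, |l| < 1 ∧ c * (l ^ 2 + 1) = 2 * η * l := by
  obtain ⟨hneg, hpos⟩ := abs_lt.1 h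
  have hcont : ContinuousOn (fun l => c * (l ^ 2 + 1) - 2 * η * l) (Icc (-1) 1) := by fun_prop
  obtain ⟨l, hl, hroot⟩ : ∃ l ∈ Ioo (-1 : ℝ) 1, c * (l ^ 2 + 1) - 2 * η * l = 0 := by
    rcases abs_cases η with ⟨habs, -⟩ | ⟨habs, -⟩ <;> rw [habs] at hneg hpos
    · exact intermediate_value_Ioo' (by norm_num) hcont ⟨by linarith, by linarith⟩
    · exact intermediate_value_Ioo (by norm_num) hcont ⟨by linarith, by linarith⟩
  exact ⟨l, abs_lt.2 hl, sub_eq_zero.1 hroot⟩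

/-- Squaring the eigenvalue condition also admits the growing solution, which the sign condition
rules out. -/
theorem eigenspace_ne_bot_iff_sq (hE : (E : ℂ) ∉ bandSet A α)
    (hsign : γ * (discrR α E * sinR E) < 0) :
    eigenspace (hamiltonian A (impurityCoupling α γ)) E ≠ ⊥ ↔
      discrR α E ^ 2 - Real.cos (A * Real.pi) ^ 2 = (γ / 4) ^ 2 * sinR E ^ 2 := by
  have hlt : |Real.cos (A * Real.pi)| < |discrR α E| := by
    rw [ofReal_mem_bandSet, not_or, not_le] at hE
    exact hE.2
  obtain ⟨l, hl, hroot⟩ := exists_decaying_root hlt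
  have hker := ker_jacobi_ne_bot_iff (γ := γ) (l := l) hE (by simpa using hl)
    (by rw [discr_ofReal]; exact_mod_cast hroot)
  rw [eigenspace_ne_bot_iff hE, hker, sinEnd_ofReal, discr_ofReal]
  set η := discrR α E
  set c := Real.cos (A * Real.pi)
  have hsq : (c * l - η) ^ 2 = η ^ 2 - c ^ 2 := by linear_combination c * hroot
  have hneg : η * (c * l - η) < 0 := by
    have hl_sq : c ^ 2 * l ^ 2 ≤ c ^ 2 :=
      mul_le_of_le_one_right (sq_nonneg c) ((sq_le_one_iff_abs_le_one l).2 hl.le)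
    linear_combination hl_sq / 2 + sq_lt_sq.2 hlt - c / 2 * hroot
  have hreal : (γ / 4 * sinR E : ℂ) = c * l - η ↔ γ / 4 * sinR E = c * l - η := by norm_cast
  rw [hreal, ← hsq, ← mul_pow, eq_comm (a := (c * l - η) ^ 2), sq_eq_sq_iff_eq_or_eq_neg,
    or_iff_left]
  intro hflip
  have hflip_mul : γ * (η * sinR E) = -(4 * (η * (c * l - η))) := by
    linear_combination 4 * η * hflip
  linarith

theorem injOn_edgeFun_mul_edgeFun (α : ℝ) (hc : |c| < 1) (n : ℕ) :
    InjOn (fun E => edgeFun α c E * edgeFun α (-c) E) (gap α c n) := by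
  have hanti := strictAntiOn_edgeFun α hc (n / 2)
  have hanti' := strictAntiOn_edgeFun α (σ := -c) (by rwa [abs_neg]) (n / 2)
  have hpos : ∀ {x}, x ∈ gap α c n →
      0 < (-1) ^ n * edgeFun α c x ∧ 0 < (-1) ^ n * edgeFun α (-c) x :=
    fun hx => (mem_gap_iff hx.1).1 hx
  rcases n.even_or_odd with hn | hn
  · simp only [hn.neg_one_pow, one_mul] at hpos
    refine StrictAntiOn.injOn fun x hx y hy hxy => ?_
    exact mul_lt_mul'' (hanti hx.1 hy.1 hxy) (hanti' hx.1 hy.1 hxy) (hpos hy).1.le (hpos hy).2.le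
  · simp only [hn.neg_one_pow, neg_one_mul, neg_pos] at hpos
    refine StrictMonoOn.injOn fun x hx y hy hxy => ?_
    rw [← neg_mul_neg (edgeFun α c x), ← neg_mul_neg (edgeFun α c y)]
    exact mul_lt_mul'' (neg_lt_neg (hanti hx.1 hy.1 hxy)) (neg_lt_neg (hanti' hx.1 hy.1 hxy))
      (neg_pos.2 (hpos hx).1).le (neg_pos.2 (hpos hx).2).le

theorem hasUniqueSimpleEigenvalueIn_gap (α : ℝ) (hc : |Real.cos (A * Real.pi)| < 1)
    (hγ : γ * (-1) ^ n < 0) :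
    HasUniqueSimpleEigenvalueIn (hamiltonian A (impurityCoupling α γ))
      (gap α (Real.cos (A * Real.pi)) n) := by
  have hnot : ∀ {E}, E ∈ gap α (Real.cos (A * Real.pi)) n → (E : ℂ) ∉ bandSet A α :=
    fun hE => notMem_bandSet_iff_exists_mem_gap.2 ⟨n, hE⟩
  have hiff : ∀ {E}, E ∈ gap α (Real.cos (A * Real.pi)) n →
      (eigenspace (hamiltonian A (impurityCoupling α γ)) E ≠ ⊥ ↔
        discrR α E ^ 2 - Real.cos (A * Real.pi) ^ 2 = (γ / 4) ^ 2 * sinR E ^ 2) := by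
    refine fun hE => eigenspace_ne_bot_iff_sq (hnot hE) ?_
    have hpos := mul_neg_of_neg_of_pos hγ (discrR_mul_sinR_pos hE)
    rwa [mul_assoc, ← mul_assoc ((-1) ^ n), ← mul_pow, neg_one_mul, neg_neg, one_pow,
      one_mul] at hpos
  have hγ_ne : γ / 4 ≠ 0 := div_ne_zero (left_ne_zero_of_mul hγ.ne) four_ne_zero
  have hprod : ∀ {E}, E ∈ gap α (Real.cos (A * Real.pi)) n →
      eigenspace (hamiltonian A (impurityCoupling α γ)) E ≠ ⊥ →
      edgeFun α (Real.cos (A * Real.pi)) E * edgeFun α (-Real.cos (A * Real.pi)) E =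
        (γ / 4) ^ 2 := by
    intro E hE hne
    have hS := sinR_ne_zero hE.1
    rw [hiff hE, ← edgeFun_mul_edgeFun hS] at hne
    exact mul_right_cancel₀ (pow_ne_zero 2 hS) hne
  obtain ⟨E, hE, heq⟩ := exists_mem_gap_discrR_sq_eq α hc hγ_ne n
  have hne := (hiff hE).2 heq
  exact ⟨E, hE, finrank_eigenspace_eq_one (hnot hE) hne, fun E' hE' hne' =>
    injOn_edgeFun_mul_edgeFun α hc n hE' hE ((hprod hE' hne').trans (hprod hE hne).symm)⟩

theorem abs_cos_mul_pi_lt_one (hA : ∀ n : ℤ, A ≠ n) : |Real.cos (A * Real.pi)| < 1 := by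
  have hsin : Real.sin (A * Real.pi) ≠ 0 :=
    Real.sin_ne_zero_iff.2 fun n hn => hA n (mul_right_cancel₀ Real.pi_ne_zero hn).symm
  rw [← sq_lt_one_iff_abs_lt_one, Real.cos_sq']
  linarith [sq_pos_of_ne_zero hsin]

end Eigenvalues

end RingChain

end

theorem mainTheorem5 (A α γ : ℝ) (hA : ∀ n : ℤ, A ≠ n) :
    RingChain.essentialSpectrum (RingChain.hamiltonian A (RingChain.impurityCoupling α γ)) =
        RingChain.spectrumSet (RingChain.hamiltonian A (RingChain.periodicCoupling α)) ∧
      ∃ G : ℕ → Set ℝ,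
        RingChain.IsGapEnumeration
          (RingChain.essentialSpectrum
            (RingChain.hamiltonian A (RingChain.impurityCoupling α γ))) G ∧
        (γ < 0 → ∀ n : ℕ, Odd (n + 1) →
          RingChain.HasUniqueSimpleEigenvalueIn
            (RingChain.hamiltonian A (RingChain.impurityCoupling α γ)) (G n)) ∧
        (0 < γ → ∀ n : ℕ, Even (n + 1) →
          RingChain.HasUniqueSimpleEigenvalueIn
            (RingChain.hamiltonian A (RingChain.impurityCoupling α γ)) (G n)) := by
  have hc := RingChain.abs_cos_mul_pi_lt_one hA
  rw [RingChain.essentialSpectrum_impurityCoupling, RingChain.spectrumSet_periodicCoupling]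
  refine ⟨rfl, RingChain.gap α (Real.cos (A * Real.pi)), RingChain.isGapEnumeration_gap α hc,
    fun hγ n hn => RingChain.hasUniqueSimpleEigenvalueIn_gap α hc ?_,
    fun hγ n hn => RingChain.hasUniqueSimpleEigenvalueIn_gap α hc ?_⟩
  · have heven : Even n := by rwa [Nat.odd_add_one, Nat.not_odd_iff_even] at hn
    rwa [heven.neg_one_pow, mul_one]
  · have hodd : Odd n := by rwa [Nat.even_add_one, Nat.not_even_iff_odd] at hn
    rwa [hodd.neg_one_pow, mul_neg_one, neg_lt_zero]
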